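/- Let $m\ge 1$, let $I$ be a set of lattice directions, and let $\alpha^{(i)}$ ($i\in I$) be nonzero, pairwise distinct real parameters. For a real variable $v$ on the lattice, $v_s$ denotes the shift by $s$ in the distinguished discrete variable $n$, $v^i$ the unit shift in the direction $i$, and $V=(v_{m-1},\dots,v_0)$, $v_0=v$. Consider the equations $$(v^i_m-v)\,v^i_{m-1}\cdots v^i=\alpha^{(i)}(v_m-v^i)\,v_{m-1}\cdots v,\qquad(1)$$ $$v^{ij}_s=v_s\,\frac{P^{(i,j)}_{s+1}}{P^{(i,j)}_s},\quad s=0,\dots,m-1,\ i\ne j,\qquad(2)$$ where $$P^{(i,j)}_s=(\alpha^{(i)}v^j_{m-1}\cdots v^j-\alpha^{(j)}v^i_{m-1}\cdots v^i)\,v_{m-1}\cdots v+\sum_{r=0}^{m-1}\gamma^{(i,j)}_{r,s}(v_{m-1}\cdots v_{r+1})^2v_r(v^i_r-v^j_r)\,v^i_{r-1}\cdots v^i\,v^j_{r-1}\cdots v^j,$$ with $\gamma^{(i,j)}_{r,s}=1$ for $s\le r$ and $\gamma^{(i,j)}_{r,s}=\alpha^{(i)}\alpha^{(j)}$ for $r<s$.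 Write (1) solved for $v^i_m$ as $v^i_m=q^{(i)}(V^i,v_m,V)$, and (2) as $V^{ij}=R^{(ij)}(V^i,V^j,V)$. Then the following holds. (a) The system (1), (2) is multidimensionally consistent. That is: (i) for all $i\ne j$, identically (as rational functions, all of them well defined for generic values) in $v_m,V,V^i,V^j$, one has $R^{(ij)}(V^i,V^j,V)=R^{(ji)}(V^j,V^i,V)=V^{ij}$, the value $x=q^{(i)}(V^{ij},v^j_m,V^j)=q^{(j)}(V^{ij},v^i_m,V^i)$ does not depend on which of the two expressions is used, and $R^{(ij)}(V^i_1,V^j_1,V_1)=(x,v^{ij}_{m-1},\dots,v^{ij}_1)$, where $v^i_m,v^j_m$ are given by (1), $V^{ij}$ by (2), and $V_1=(v_m,\dots,v_1)$, similarly for $V^i_1$, $V^j_1$; (ii) for all pairwise distinct $i,j,k$, identically in $V,V^i,V^j,V^k$ (in the same sense), $$R^{(jk)}(V^{ij},V^{ik},V^i)=R^{(ik)}(V^{ij},V^{jk},V^j)=R^{(ij)}(V^{ik},V^{jk},V^k),$$ where $V^{ij},V^{ik},V^{jk}$ are given by (2). (b) The system (1), (2) is consistent with the lattice equation $$\partial_tv=\frac{v_{m-1}\cdots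 v}{v_{-1}\cdots v_{-m}}(v_m-v_{-m}).\qquad(3)$$ That is, if (3) is imposed on $v$ and $v^i$ (respectively on $v,v^i,v^j,v^{ij}$), then the relation obtained by differentiating (1) (respectively (2)) with respect to $t$ holds at all $n$, for all nowhere vanishing solutions of (1) (respectively of the system (1), (2) on the four sequences $v,v^i,v^j,v^{ij}$, with all denominators in (2) nonzero). (c) The substitution $u=v_m/v$ maps nowhere vanishing solutions of (3) to solutions of $$\partial_tu=u^2(u_m\cdots u_1-u_{-1}\cdots u_{-m})-u(u_{m-1}\cdots u_1-u_{-1}\cdots u_{1-m}).$$ -/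

import Mathlib

namespace MQuad

noncomputable section

/-- A property of a point `x : σ → ℝ` (`σ` is the finite set of independent variables) holds for
generic `x` if it holds off the zero set of a nonzero polynomial.  For rational expressions this is
what it means to be defined and to satisfy an identity "identically with respect to" the independent
variables. -/
def Generically {σ : Type*} (p : (σ → ℝ) → Prop) : Prop :=
  ∃ D : MvPolynomial σ ℝ, D ≠ 0 ∧ ∀ x : σ → ℝ, MvPolynomial.eval x D ≠ 0 → p x

/-- `(V_0, …, V_{m-1})` followed by the value `a` in position `m`. -/
def ext {m : ℕ} (V : Fin m → ℝ) (a : ℝ) : Fin (m + 1) → ℝ :=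
  Fin.snoc (α := fun _ => ℝ) V a

/-- The first `m` entries `V = (v_0, …, v_{m-1})` of `(v_0, …, v_m)`. -/
def low {m : ℕ} (v : Fin (m + 1) → ℝ) : Fin m → ℝ := fun s => v s.castSucc

/-- The last `m` entries `V_1 = (v_1, …, v_m)` of `(v_0, …, v_m)`. -/
def up {m : ℕ} (v : Fin (m + 1) → ℝ) : Fin m → ℝ := fun s => v s.succ

/-- A system consisting of `m`-quad-equations in resolved form
`v^i_m = q^{(i)}(V^i, (v_0, …, v_m))` and of `m`-component quad-equations
`V^{ij} = R^{(ij)}(V^i, V^j, V)`.  The right hand sides are partial maps (`a ∈ q i W v` says that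
`q i` is defined at `(W, v)` and has the value `a` there). -/
structure QuadSystem (ι : Type*) (m : ℕ) where
  q : ι → (Fin m → ℝ) → (Fin (m + 1) → ℝ) → Part ℝ
  R : ι → ι → (Fin m → ℝ) → (Fin m → ℝ) → (Fin m → ℝ) → Part (Fin m → ℝ)

/-- Consistency on the sublattice `(n_i, n_j, n)`, at the initial data `v = (v_0, …, v_m)`, `Vi`,
`Vj`: all maps involved are defined; `V^{ij}` does not depend on the order of `i` and `j`; the two
ways to compute `v^{ij}_m` from the `m`-quad-equations give the same value `x`; and `R^{(ij)}` at
the data shifted by `T` gives the shifted vector `(v^{ij}_1, …, v^{ij}_{m-1}, x)`. -/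
def QuadSystem.ConsistentIJ {ι : Type*} {m : ℕ} (S : QuadSystem ι m) (i j : ι)
    (v : Fin (m + 1) → ℝ) (Vi Vj : Fin m → ℝ) : Prop :=
  ∃ vim ∈ S.q i Vi v, ∃ vjm ∈ S.q j Vj v,
  ∃ Vij ∈ S.R i j Vi Vj (low v), Vij ∈ S.R j i Vj Vi (low v) ∧
  ∃ x : ℝ, x ∈ S.q i Vij (ext Vj vjm) ∧ x ∈ S.q j Vij (ext Vi vim) ∧
    up (ext Vij x) ∈ S.R i j (up (ext Vi vim)) (up (ext Vj vjm)) (up v)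

/-- Consistency on the sublattice `(n_i, n_j, n_k)`, at the initial data `V, Vi, Vj, Vk`: all maps
involved are defined and the three ways to compute `V^{ijk}` give the same value. -/
def QuadSystem.ConsistentIJK {ι : Type*} {m : ℕ} (S : QuadSystem ι m) (i j k : ι)
    (V Vi Vj Vk : Fin m → ℝ) : Prop :=
  ∃ Vij ∈ S.R i j Vi Vj V, ∃ Vik ∈ S.R i k Vi Vk V, ∃ Vjk ∈ S.R j k Vj Vk V,
  ∃ Vijk : Fin m → ℝ,
    Vijk ∈ S.R j k Vij Vik Vi ∧ Vijk ∈ S.R i k Vij Vjk Vj ∧ Vijk ∈ S.R i j Vik Vjk Vk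

/-- Multidimensional consistency: the two consistency conditions hold identically with respect to
the initial data, for all pairs and all triples of pairwise distinct directions. -/
structure QuadSystem.MultidimensionallyConsistent {ι : Type*} {m : ℕ} (S : QuadSystem ι m) :
    Prop where
  pair : ∀ i j : ι, i ≠ j →
    Generically fun x : Fin (m + 1) ⊕ Fin m ⊕ Fin m → ℝ =>
      S.ConsistentIJ i j (fun s => x (.inl s)) (fun s => x (.inr (.inl s)))
        (fun s => x (.inr (.inr s)))
  triple : ∀ i j k : ι, i ≠ j → j ≠ k → i ≠ k →
    Generically fun x : Fin 4 × Fin m → ℝ =>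
      S.ConsistentIJK i j k (fun s => x (0, s)) (fun s => x (1, s)) (fun s => x (2, s))
        (fun s => x (3, s))

/-- Left minus right hand side of
`(w_m - v) w_{m-1} ⋯ w = a (v_m - w) v_{m-1} ⋯ v`, where `w = v^i` and `a = α^{(i)}`. -/
def quadExpr (m : ℕ) (a : ℝ) (w v : Fin (m + 1) → ℝ) : ℝ :=
  (w (Fin.last m) - v 0) * ∏ s, low w s - a * (v (Fin.last m) - w 0) * ∏ s, low v s

/-- The `m`-quad-equation solved for `w_m`: defined where there is a unique solution. -/
def quadResolved (m : ℕ) (a : ℝ) (W : Fin m → ℝ) (v : Fin (m + 1) → ℝ) : Part ℝ where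
  Dom := ∃! x : ℝ, quadExpr m a (ext W x) v = 0
  get h := h.choose

/-- `γ^{(i,j)}_{r,s}`, with `a = α^{(i)}`, `b = α^{(j)}`. -/
def gam (a b : ℝ) (r s : ℕ) : ℝ := if s ≤ r then 1 else a * b

/-- The polynomial `P^{(i,j)}_s`, with `a = α^{(i)}`, `b = α^{(j)}`. -/
def superP (m : ℕ) (a b : ℝ) (Vi Vj V : Fin m → ℝ) (s : ℕ) : ℝ :=
  (a * ∏ k, Vj k - b * ∏ k, Vi k) * ∏ k, V k
    + ∑ r : Fin m, gam a b r s * (∏ k ∈ Finset.Ioi r, V k) ^ 2 * V r * (Vi r - Vj r)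
        * (∏ k ∈ Finset.Iio r, Vi k) * ∏ k ∈ Finset.Iio r, Vj k

/-- The superposition `v^{ij}_s = v_s P_{s+1} / P_s`, `0 ≤ s ≤ m - 1`, defined where no denominator
vanishes. -/
def superpos (m : ℕ) (a b : ℝ) (Vi Vj V : Fin m → ℝ) : Part (Fin m → ℝ) where
  Dom := ∀ s : Fin m, superP m a b Vi Vj V s ≠ 0
  get _ := fun s => V s * (superP m a b Vi Vj V (s + 1) / superP m a b Vi Vj V s)

/-- The system of the `m`-quad-equations and of the superposition formulas, with parameters
`α^{(i)}`. -/
def dSK {ι : Type*} (m : ℕ) (α : ι → ℝ) : QuadSystem ι m where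
  q i := quadResolved m (α i)
  R i j := superpos m (α i) (α j)

/-- `(v_n, …, v_{n+l-1})`. -/
def window (l : ℕ) (v : ℤ → ℝ) (n : ℤ) : Fin l → ℝ := fun k => v (n + (k : ℕ))

/-- The right hand side of
`∂_t v = (v_{m-1} ⋯ v) / (v_{-1} ⋯ v_{-m}) (v_m - v_{-m})`. -/
def vLattice (m : ℕ) (v : ℤ → ℝ) (n : ℤ) : ℝ :=
  (∏ k ∈ Finset.range m, v (n + k)) / (∏ k ∈ Finset.range m, v (n - (k + 1)))
    * (v (n + m) - v (n - m))

/-- The right hand side of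
`∂_t u = u² (u_m ⋯ u_1 - u_{-1} ⋯ u_{-m}) - u (u_{m-1} ⋯ u_1 - u_{-1} ⋯ u_{1-m})`. -/
def uLattice (m : ℕ) (u : ℤ → ℝ) (n : ℤ) : ℝ :=
  u n ^ 2 * (∏ k ∈ Finset.range m, u (n + (k + 1)) - ∏ k ∈ Finset.range m, u (n - (k + 1)))
    - u n * (∏ k ∈ Finset.range (m - 1), u (n + (k + 1))
        - ∏ k ∈ Finset.range (m - 1), u (n - (k + 1)))

/-- `v(n, τ)` satisfies the lattice equation `∂_t v = A(v)` at the time `t`. -/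
def SolvesAt (A : (ℤ → ℝ) → ℤ → ℝ) (v : ℝ → ℤ → ℝ) (t : ℝ) : Prop :=
  ∀ n : ℤ, HasDerivAt (fun τ => v τ n) (A (v t) n) t

/-- The nowhere vanishing sequences `v`, `w` are related by the `m`-quad-equation with the
parameter `a`, at all `n`. -/
def QuadRelated (m : ℕ) (a : ℝ) (v w : ℤ → ℝ) : Prop :=
  (∀ n, v n ≠ 0) ∧ (∀ n, w n ≠ 0) ∧
    ∀ n, quadExpr m a (window (m + 1) w n) (window (m + 1) v n) = 0

/-- Consistency of the system with the lattice equation `∂_t v = A(v)`: the relations obtained from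
the equations of the system by differentiation in virtue of the lattice equation (imposed on all of
`v, v^i, v^j, v^{ij}`) hold in virtue of the system itself. -/
structure ConsistentWithLattice {ι : Type*} (m : ℕ) (α : ι → ℝ) (A : (ℤ → ℝ) → ℤ → ℝ) :
    Prop where
  quad : ∀ (i : ι) (v vi : ℝ → ℤ → ℝ) (t : ℝ),
    QuadRelated m (α i) (v t) (vi t) → SolvesAt A v t → SolvesAt A vi t →
    ∀ n : ℤ, HasDerivAt
      (fun τ => quadExpr m (α i) (window (m + 1) (vi τ) n) (window (m + 1) (v τ) n)) 0 t
  super : ∀ (i j : ι), i ≠ j → ∀ (v vi vj vij : ℝ → ℤ → ℝ) (t : ℝ),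
    QuadRelated m (α i) (v t) (vi t) → QuadRelated m (α j) (v t) (vj t) →
    QuadRelated m (α i) (vj t) (vij t) → QuadRelated m (α j) (vi t) (vij t) →
    (∀ n : ℤ, window m (vij t) n ∈
      superpos m (α i) (α j) (window m (vi t) n) (window m (vj t) n) (window m (v t) n)) →
    SolvesAt A v t → SolvesAt A vi t → SolvesAt A vj t → SolvesAt A vij t →
    ∀ (n : ℤ) (s : Fin m), HasDerivAt
      (fun τ => window m (vij τ) n s - window m (v τ) n s *
        (superP m (α i) (α j) (window m (vi τ) n) (window m (vj τ) n) (window m (v τ) n) (s + 1) /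
          superP m (α i) (α j) (window m (vi τ) n) (window m (vj τ) n) (window m (v τ) n) s)) 0 t

end

end MQuad

/-! Everything is rewritten in tau functions: put `v = f_1 / f`, `v^i = f^i_1 / f^i`. The products
telescope and equation (1) becomes bilinear: `f g_{m+1} - f_1 g_m = a (f_{m+1} g - f_m g_1)` with `g
= f^i`. In terms of `p = f^i / f` this is linear, `e (p_{m+1} - a p_0) = d (p_m - a p_1)`, where `e
= f f_{m+1}` and `d = f_1 f_m` are the same for all directions.

For `p = f^i / f` and `q = f^j / f`, the polynomial `P_s` is, up to a factor independent of `s`, a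
boundary term plus weighted sums of Casorati determinants of `p` and `q`; this is `sol`
(`superP_mul`). So (2) says that `f^{ij} = f * sol`. Swapping directions changes only the sign of
`sol`, which is invisible in ratios. Eliminating `d / e` between the linear equations for `p` and
`q` shows that `sol` commutes with the shift (`sol_shift`); `sol_quad` shows that it solves the next
bilinear equations. Iterating the superposition gives `f^{ijk} / f`, proportional to an expression
`sol₃` symmetric up to sign (`sol_sol`). These identities need certain polynomials not to vanish;
explicit step sequences show that the polynomials are nonzero.

For the flow (3), the logarithmic derivative `rate` of `v` changes along an edge of the lattice by a
total difference of `pot` (`rate_sub_rate`), so derivatives of products telescope. The derivative of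
(1) then splits into two bilinear identities, at the two ends of the stencil. For (2), the
derivatives of the Casorati determinants telescope to `flux` (`caso_pot`, `boundary_pot`), and the
same `flux` is the potential for the composed edge from `v` to `v^{ij}` (`pot_add_pot`). Statement
(c) is a direct computation in `f`. -/

namespace MQuad

/-! ### Tau functions on a finite window. -/

/-- `V` is the sequence of the ratios of consecutive entries of `f`. -/
def IsRatio {l : ℕ} (V : Fin l → ℝ) (f : ℕ → ℝ) : Prop :=
  ∀ s : Fin l, V s * f s = f (s + 1)

theorem IsRatio.prod_filter {l : ℕ} {V : Fin l → ℝ} {f : ℕ → ℝ} (h : IsRatio V f) :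
    ∀ n, n ≤ l → (∏ k with k.val < n, V k) * f 0 = f n := by
  intro n
  induction n with
  | zero => intro _; simp
  | succ n ih =>
    intro hn
    have hs : (Finset.univ.filter fun k : Fin l => k.val < n + 1)
        = insert ⟨n, hn⟩ (Finset.univ.filter fun k : Fin l => k.val < n) := by
      ext k; simp [Fin.ext_iff]; omega
    rw [hs, Finset.prod_insert (by simp), mul_assoc, ih (by omega)]
    exact h ⟨n, hn⟩

theorem IsRatio.prod {l : ℕ} {V : Fin l → ℝ} {f : ℕ → ℝ} (h : IsRatio V f) :
    (∏ k, V k) * f 0 = f l := by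
  simpa using h.prod_filter l le_rfl

theorem IsRatio.prod_Iio {l : ℕ} {V : Fin l → ℝ} {f : ℕ → ℝ} (h : IsRatio V f) (r : Fin l) :
    (∏ k ∈ Finset.Iio r, V k) * f 0 = f r := by
  rw [← h.prod_filter r r.2.le]
  congr 2
  ext k; simp

theorem IsRatio.prod_Ioi {l : ℕ} {V : Fin l → ℝ} {f : ℕ → ℝ} (h : IsRatio V f) (r : Fin l) :
    (∏ k ∈ Finset.Ioi r, V k) * f (r + 1) = f l := by
  have hs : (Finset.univ : Finset (Fin l)) =
      (Finset.univ.filter fun k : Fin l => k.val < r + 1) ∪ Finset.Ioi r := by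
    ext k
    simp only [Finset.mem_univ, Finset.mem_union, Finset.mem_filter, Finset.mem_Ioi, Fin.lt_def,
      true_and, true_iff]
    omega
  have hd : Disjoint (Finset.univ.filter fun k : Fin l => k.val < r + 1) (Finset.Ioi r) := by
    rw [Finset.disjoint_left]
    intro k
    simp only [Finset.mem_univ, Finset.mem_filter, Finset.mem_Ioi, Fin.lt_def, true_and]
    omega
  rw [← h.prod, hs, Finset.prod_union hd, ← h.prod_filter (r + 1) r.2]
  ring

theorem IsRatio.eq {l : ℕ} {V : Fin l → ℝ} {f g : ℕ → ℝ} (hf : IsRatio V f) (hg : IsRatio V g)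
    (h0 : f 0 = g 0) (n : ℕ) (hn : n ≤ l) : f n = g n := by
  rw [← hf.prod_filter n hn, ← hg.prod_filter n hn, h0]

theorem IsRatio.low {m : ℕ} {v : Fin (m + 1) → ℝ} {f : ℕ → ℝ} (h : IsRatio v f) :
    IsRatio (low v) f := fun s => h s.castSucc

theorem IsRatio.up {m : ℕ} {v : Fin (m + 1) → ℝ} {f : ℕ → ℝ} (h : IsRatio v f) :
    IsRatio (up v) (fun k => f (k + 1)) := fun s => by simpa [MQuad.up] using h s.succ

/-- The sequence with initial value `1` and with the ratios `V`, continued by a constant. -/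
noncomputable def seqOf {l : ℕ} (V : Fin l → ℝ) (k : ℕ) : ℝ :=
  ∏ r ∈ Finset.range k, if h : r < l then V ⟨r, h⟩ else 1

theorem isRatio_seqOf {l : ℕ} (V : Fin l → ℝ) : IsRatio V (seqOf V) := fun s => by
  simp [seqOf, Finset.prod_range_succ, mul_comm]

theorem seqOf_zero {l : ℕ} (V : Fin l → ℝ) : seqOf V 0 = 1 := by simp [seqOf]

theorem seqOf_ne_zero {l : ℕ} (V : Fin l → ℝ) (k : ℕ) (h : ∀ s : Fin l, s.val < k → V s ≠ 0) :
    seqOf V k ≠ 0 := by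
  refine Finset.prod_ne_zero_iff.2 fun r hr => ?_
  split_ifs with hl
  · exact h _ (by simpa using hr)
  · exact one_ne_zero

/-! ### Superposition as a sum of Casorati determinants. -/

/-- The Casorati determinant of `p` and `q`. -/
def caso (p q : ℕ → ℝ) (r : ℕ) : ℝ := p (r + 1) * q r - q (r + 1) * p r

/-- The ratio of the solutions `f^{ij}` and `f` of the bilinear form of the equations, in terms of
the ratios `p = f^i / f`, `q = f^j / f`. -/
def sol (m : ℕ) (a b : ℝ) (p q : ℕ → ℝ) (k : ℕ) : ℝ :=
  a * q m * p 0 - b * p m * q 0 + ∑ r ∈ Finset.range m, caso p q r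
    + (a * b - 1) * ∑ r ∈ Finset.range k, caso p q r

theorem sol_succ (m : ℕ) (a b : ℝ) (p q : ℕ → ℝ) (k : ℕ) :
    sol m a b p q (k + 1) = sol m a b p q k + (a * b - 1) * caso p q k := by
  simp only [sol, Finset.sum_range_succ]; ring

theorem sol_swap (m : ℕ) (a b : ℝ) (p q : ℕ → ℝ) (k : ℕ) :
    sol m b a q p k = -sol m a b p q k := by
  have h : ∀ n, ∑ r ∈ Finset.range n, caso q p r = -∑ r ∈ Finset.range n, caso p q r := by
    intro n
    rw [← Finset.sum_neg_distrib]
    exact Finset.sum_congr rfl fun r _ => by simp only [caso]; ring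
  simp only [sol, h]; ring

theorem sol_eq_sum (m : ℕ) (a b : ℝ) (p q : ℕ → ℝ) (k : ℕ) (hk : k ≤ m) :
    sol m a b p q k = a * q m * p 0 - b * p m * q 0
      + ∑ r ∈ Finset.range m, gam a b r k * caso p q r := by
  obtain ⟨l, rfl⟩ := Nat.exists_eq_add_of_le hk
  have h1 : ∑ r ∈ Finset.range k, gam a b r k * caso p q r
      = a * b * ∑ r ∈ Finset.range k, caso p q r := by
    rw [Finset.mul_sum]
    refine Finset.sum_congr rfl fun r hr => ?_
    rw [gam, if_neg (by simpa using hr)]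
  have h2 : ∑ r ∈ Finset.range l, gam a b (k + r) k * caso p q (k + r)
      = ∑ r ∈ Finset.range l, caso p q (k + r) :=
    Finset.sum_congr rfl fun r _ => by rw [gam, if_pos (by omega), one_mul]
  rw [sol, Finset.sum_range_add, Finset.sum_range_add, h1, h2]
  ring

/-- All products telescope, and the `r`-th summand becomes a Casorati determinant. The
proportionality factor does not depend on `s`, so it drops out of `P_{s+1} / P_s`. Only the initial
values of `f`, `p`, `q` enter the left factor; later zeros are harmless. -/
theorem superP_mul {m : ℕ} (a b : ℝ) {V Vi Vj : Fin m → ℝ} {f p q : ℕ → ℝ}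
    (hV : IsRatio V f) (hVi : IsRatio Vi fun k => f k * p k)
    (hVj : IsRatio Vj fun k => f k * q k) (s : ℕ) (hs : s ≤ m) :
    superP m a b Vi Vj V s * (p 0 * q 0 * f 0 ^ 2) = f m ^ 2 * sol m a b p q s := by
  have h1 : ∑ r : Fin m, gam a b r s * (∏ k ∈ Finset.Ioi r, V k) ^ 2 * V r * (Vi r - Vj r)
        * (∏ k ∈ Finset.Iio r, Vi k) * (∏ k ∈ Finset.Iio r, Vj k) * (p 0 * q 0 * f 0 ^ 2)
      = ∑ r ∈ Finset.range m, f m ^ 2 * (gam a b r s * caso p q r) := by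
    rw [← Fin.sum_univ_eq_sum_range fun r => f m ^ 2 * (gam a b r s * caso p q r)]
    refine Finset.sum_congr rfl fun r _ => ?_
    have e1 := hV.prod_Ioi r
    have e2 := hVi.prod_Iio r
    have e3 := hVj.prod_Iio r
    have e4 := hV r
    have e5 := hVi r
    have e6 := hVj r
    simp only at e2 e3 e5 e6
    generalize (∏ k ∈ Finset.Ioi r, V k) = A at *
    generalize (∏ k ∈ Finset.Iio r, Vi k) = B at *
    generalize (∏ k ∈ Finset.Iio r, Vj k) = C at *
    calc gam a b r s * A ^ 2 * V r * (Vi r - Vj r) * B * C * (p 0 * q 0 * f 0 ^ 2)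
        = gam a b r s * A ^ 2 * V r * (Vi r - Vj r) * (B * (f 0 * p 0)) * (C * (f 0 * q 0)) := by
          ring
      _ = gam a b r s * A ^ 2 * V r * (Vi r * (f r * p r) * (f r * q r)
            - Vj r * (f r * q r) * (f r * p r)) := by rw [e2, e3]; ring
      _ = gam a b r s * A ^ 2 * (V r * f r) * f (r + 1) * caso p q r := by
          rw [e5, e6, caso]; ring
      _ = gam a b r s * (A * f (r + 1)) ^ 2 * caso p q r := by rw [e4]; ring
      _ = f m ^ 2 * (gam a b r s * caso p q r) := by rw [e1]; ring
  rw [sol_eq_sum m a b p q s hs, superP, add_mul, Finset.sum_mul, h1, mul_add, Finset.mul_sum]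
  have e1 := hV.prod
  have e2 := hVi.prod
  have e3 := hVj.prod
  congr 1
  calc (a * ∏ k, Vj k - b * ∏ k, Vi k) * (∏ k, V k) * (p 0 * q 0 * f 0 ^ 2)
      = (a * ((∏ k, Vj k) * (f 0 * q 0)) * p 0 - b * ((∏ k, Vi k) * (f 0 * p 0)) * q 0)
        * ((∏ k, V k) * f 0) := by ring
    _ = _ := by rw [e1, e2, e3]; ring

theorem quadExpr_mul {m : ℕ} (a : ℝ) {w v : Fin (m + 1) → ℝ} {f g : ℕ → ℝ}
    (hv : IsRatio v f) (hw : IsRatio w g) :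
    quadExpr m a w v * (f 0 * g 0) = (f 0 * g (m + 1) - f 1 * g m)
      - a * (f (m + 1) * g 0 - f m * g 1) := by
  have e1 := hv.low.prod
  have e2 := hw.low.prod
  have e3 : v (Fin.last m) * f m = f (m + 1) := by simpa using hv (Fin.last m)
  have e4 : w (Fin.last m) * g m = g (m + 1) := by simpa using hw (Fin.last m)
  have e5 : v 0 * f 0 = f 1 := by simpa using hv 0
  have e6 : w 0 * g 0 = g 1 := by simpa using hw 0
  rw [quadExpr, ← e3, ← e4, ← e5, ← e6, ← e1, ← e2]
  ring

/-- The two linear equations share `e` and `d`, so the vectors `(p_{m+1} - a p_0, p_m - a p_1)` and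
the analogous one for `q` are proportional. Their vanishing determinant is exactly the change of the
boundary terms and sums under the shift. -/
theorem sol_shift {m : ℕ} {a b e d : ℝ} {p q : ℕ → ℝ} (he : e ≠ 0)
    (hp : e * (p (m + 1) - a * p 0) = d * (p m - a * p 1))
    (hq : e * (q (m + 1) - b * q 0) = d * (q m - b * q 1)) (s : ℕ) :
    sol m a b (fun k => p (k + 1)) (fun k => q (k + 1)) s = sol m a b p q (s + 1) := by
  have hc : ∀ n, ∑ r ∈ Finset.range n, caso (fun k => p (k + 1)) (fun k => q (k + 1)) r
      = ∑ r ∈ Finset.range (n + 1), caso p q r - caso p q 0 := by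
    intro n
    rw [Finset.sum_range_succ']
    simp [caso]
  have h0 : (p (m + 1) - a * p 0) * (q m - b * q 1) - (q (m + 1) - b * q 0) * (p m - a * p 1)
      = 0 := by
    apply mul_left_cancel₀ he
    linear_combination (q m - b * q 1) * hp - (p m - a * p 1) * hq
  rw [sol, sol, hc, hc, Finset.sum_range_succ _ m]
  simp only [caso, zero_add] at *
  linear_combination h0

/-- This is the bilinear equation with parameter `a` between `f^j = f q` and `f^{ij} = f * sol`. All
values of `sol` involved reduce to one sum `Ω` and the entries at `0, 1, m, m + 1`. -/
theorem sol_quad {m : ℕ} {a b e d : ℝ} {p q : ℕ → ℝ}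
    (hp : e * (p (m + 1) - a * p 0) = d * (p m - a * p 1))
    (hq : e * (q (m + 1) - b * q 0) = d * (q m - b * q 1)) :
    e * (q 0 * sol m a b p q (m + 1) - a * q (m + 1) * sol m a b p q 0)
      = d * (q 1 * sol m a b p q m - a * q m * sol m a b p q 1) := by
  have h1 := sol_succ m a b p q m
  have h2 := sol_succ m a b p q 0
  have h3 : sol m a b p q 0 = a * q m * p 0 - b * p m * q 0
    + ∑ r ∈ Finset.range m, caso p q r := by simp [sol]
  rw [h1, h2, h3, sol]
  generalize ∑ r ∈ Finset.range m, caso p q r = Ω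
  simp only [caso, zero_add]
  linear_combination (a * b - 1) * q 0 * q m * hp
    - ((a * b - 1) * q 0 * p m + a * (a * q m * p 0 - b * p m * q 0) + a * Ω) * hq

/-! ### Superposition of three directions. -/

/-- The ratio of the solutions `f^{ijk}` and `f` of the bilinear form of the equations. -/
def sol₃ (m : ℕ) (a b c : ℝ) (p q h : ℕ → ℝ) (s : ℕ) : ℝ :=
  (a * b - 1) * (a * c - 1) * p s * sol m b c q h s
    - (a * b - 1) * (b * c - 1) * q s * sol m a c p h s
    + (a * c - 1) * (b * c - 1) * h s * sol m a b p q s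

/-- Since `sol` has increments `(a b - 1) * caso`, the Casorati determinant of the two new ratios is
a total difference plus a multiple of `caso q h`. -/
theorem sum_caso_sol (m : ℕ) (a b c : ℝ) {p q h : ℕ → ℝ} (hp : ∀ k, p k ≠ 0) (s : ℕ) :
    ∑ r ∈ Finset.range s, caso (fun k => sol m a b p q k / p k) (fun k => sol m a c p h k / p k) r
      = (-(a * b - 1) * (q s / p s) * sol m a c p h s + (a * c - 1) * (h s / p s) * sol m a b p q s
        + (a * b - 1) * (a * c - 1) * ∑ r ∈ Finset.range s, caso q h r)
        - (-(a * b - 1) * (q 0 / p 0) * sol m a c p h 0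
          + (a * c - 1) * (h 0 / p 0) * sol m a b p q 0) := by
  induction s with
  | zero => simp
  | succ s ih =>
    rw [Finset.sum_range_succ, Finset.sum_range_succ, ih]
    have h1 := hp s
    have h2 := hp (s + 1)
    have h3 := hp 0
    simp only [caso, sol_succ]
    generalize sol m a b p q s = A
    generalize sol m a c p h s = B
    field_simp
    ring

/-- Superposing `f^{ij}` and `f^{ik}` over `f^i` gives `sol₃`, in which the base direction is no
longer distinguished. The consistency around the cube reduces to this. -/
theorem sol_sol (m : ℕ) (a b c : ℝ) {p q h : ℕ → ℝ} (hp : ∀ k, p k ≠ 0) (s : ℕ) :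
    p s * sol m b c (fun k => sol m a b p q k / p k) (fun k => sol m a c p h k / p k) s
      = sol₃ m a b c p q h s := by
  rw [sol, sum_caso_sol m a b c hp, sum_caso_sol m a b c hp, sol₃, sol.eq_def m b c q h s]
  have h1 := hp s
  have h2 := hp m
  have h3 := hp 0
  generalize sol m a b p q s = A
  generalize sol m a c p h s = B
  have e1 : sol m a b p q 0 = a * q m * p 0 - b * p m * q 0
    + ∑ r ∈ Finset.range m, caso p q r := by simp [sol]
  have e2 : sol m a c p h 0 = a * h m * p 0 - c * p m * h 0
    + ∑ r ∈ Finset.range m, caso p h r := by simp [sol]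
  simp only [e1, e2]
  rw [sol, sol]
  generalize ∑ r ∈ Finset.range m, caso p q r = Ω₁
  generalize ∑ r ∈ Finset.range m, caso p h r = Ω₂
  generalize ∑ r ∈ Finset.range m, caso q h r = Ω₃
  generalize ∑ r ∈ Finset.range s, caso q h r = Ω₄
  field_simp
  ring

theorem sol₃_swap₁₂ (m : ℕ) (a b c : ℝ) (p q h : ℕ → ℝ) (s : ℕ) :
    sol₃ m b a c q p h s = -sol₃ m a b c p q h s := by
  simp only [sol₃, sol_swap m a b p q]; ring

theorem sol₃_rotate (m : ℕ) (a b c : ℝ) (p q h : ℕ → ℝ) (s : ℕ) :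
    sol₃ m c a b h p q s = sol₃ m a b c p q h s := by
  simp only [sol₃, sol_swap m b c q h, sol_swap m a c p h]; ring

/-! ### Polynomial functions and genericity. -/

/-- Polynomial functions of the variables indexed by `σ`. -/
def IsPoly {σ : Type*} (F : (σ → ℝ) → ℝ) : Prop :=
  ∃ D : MvPolynomial σ ℝ, ∀ x, MvPolynomial.eval x D = F x

section IsPoly

variable {σ : Type*} {F G : (σ → ℝ) → ℝ}

theorem IsPoly.const (c : ℝ) : IsPoly fun _ : σ → ℝ => c := ⟨.C c, by simp⟩

theorem IsPoly.coord (i : σ) : IsPoly fun x : σ → ℝ => x i := ⟨.X i, by simp⟩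

theorem IsPoly.add (hF : IsPoly F) (hG : IsPoly G) : IsPoly fun x => F x + G x := by
  obtain ⟨P, hP⟩ := hF
  obtain ⟨Q, hQ⟩ := hG
  exact ⟨P + Q, by simp [hP, hQ]⟩

theorem IsPoly.sub (hF : IsPoly F) (hG : IsPoly G) : IsPoly fun x => F x - G x := by
  obtain ⟨P, hP⟩ := hF
  obtain ⟨Q, hQ⟩ := hG
  exact ⟨P - Q, by simp [hP, hQ]⟩

theorem IsPoly.mul (hF : IsPoly F) (hG : IsPoly G) : IsPoly fun x => F x * G x := by
  obtain ⟨P, hP⟩ := hF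
  obtain ⟨Q, hQ⟩ := hG
  exact ⟨P * Q, by simp [hP, hQ]⟩

theorem IsPoly.pow (hF : IsPoly F) (n : ℕ) : IsPoly fun x => F x ^ n := by
  obtain ⟨P, hP⟩ := hF
  exact ⟨P ^ n, by simp [hP]⟩

theorem IsPoly.sum {κ : Type*} (s : Finset κ) {F : κ → (σ → ℝ) → ℝ} (hF : ∀ k, IsPoly (F k)) :
    IsPoly fun x => ∑ k ∈ s, F k x := by
  choose P hP using hF
  exact ⟨∑ k ∈ s, P k, by simp [hP]⟩

theorem IsPoly.prod {κ : Type*} (s : Finset κ) {F : κ → (σ → ℝ) → ℝ} (hF : ∀ k, IsPoly (F k)) :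
    IsPoly fun x => ∏ k ∈ s, F k x := by
  choose P hP using hF
  exact ⟨∏ k ∈ s, P k, by simp [hP]⟩

theorem IsPoly.generically_ne_zero (hF : IsPoly F) (h : ∃ x, F x ≠ 0) :
    Generically fun x => F x ≠ 0 := by
  obtain ⟨P, hP⟩ := hF
  obtain ⟨x, hx⟩ := h
  refine ⟨P, ?_, fun y hy => by rwa [hP] at hy⟩
  rintro rfl
  exact hx (by rw [← hP]; simp)

theorem IsPoly.superP {m : ℕ} (a b : ℝ) {Vi Vj V : (σ → ℝ) → Fin m → ℝ}
    (hi : ∀ k, IsPoly fun x => Vi x k) (hj : ∀ k, IsPoly fun x => Vj x k)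
    (h : ∀ k, IsPoly fun x => V x k) (s : ℕ) :
    IsPoly fun x => superP m a b (Vi x) (Vj x) (V x) s := by
  refine .add (.mul (.sub (.mul (.const a) (.prod _ hj)) (.mul (.const b) (.prod _ hi)))
    (.prod _ h)) (.sum _ fun r => ?_)
  exact .mul (.mul (.mul (.mul (.mul (.const _) (.pow (.prod _ h) 2)) (h r))
    (.sub (hi r) (hj r))) (.prod _ hi)) (.prod _ hj)

theorem IsPoly.seqOf {m : ℕ} {V : (σ → ℝ) → Fin m → ℝ} (h : ∀ k, IsPoly fun x => V x k) (k : ℕ) :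
    IsPoly fun x => seqOf (V x) k := by
  refine .prod _ fun r => ?_
  by_cases hr : r < m
  · simpa [hr] using h ⟨r, hr⟩
  · simpa [hr] using IsPoly.const 1

theorem Generically.mono {p q : (σ → ℝ) → Prop} (hp : Generically p) (h : ∀ x, p x → q x) :
    Generically q := by
  obtain ⟨P, h0, hP⟩ := hp
  exact ⟨P, h0, fun x hx => h x (hP x hx)⟩

theorem Generically.and {p q : (σ → ℝ) → Prop} (hp : Generically p) (hq : Generically q) :
    Generically fun x => p x ∧ q x := by
  obtain ⟨P, h0, hP⟩ := hp
  obtain ⟨Q, h1, hQ⟩ := hq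
  refine ⟨P * Q, mul_ne_zero h0 h1, fun x hx => ?_⟩
  rw [map_mul] at hx
  exact ⟨hP x (left_ne_zero_of_mul hx), hQ x (right_ne_zero_of_mul hx)⟩

theorem Generically.forall {κ : Type*} (s : Finset κ) {p : κ → (σ → ℝ) → Prop}
    (hp : ∀ k ∈ s, Generically (p k)) : Generically fun x => ∀ k ∈ s, p k x := by
  classical
  induction s using Finset.induction_on with
  | empty => exact ⟨1, one_ne_zero, by simp⟩
  | insert a s _ ih =>
    refine ((hp a (by simp)).and (ih fun k hk => hp k (by simp [hk]))).mono fun x hx => ?_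
    simpa using hx

theorem generically_forall_coord_ne_zero {κ : Type*} [Fintype κ] (e : κ → σ) :
    Generically fun x : σ → ℝ => ∀ k, x (e k) ≠ 0 :=
  (Generically.forall Finset.univ fun k _ =>
    (IsPoly.coord (e k)).generically_ne_zero ⟨fun _ => 1, one_ne_zero⟩).mono
    fun _ hx k => hx k (by simp)

end IsPoly

/-! ### Consistency away from the zeros of the denominators. -/

theorem mem_superpos {m : ℕ} {a b : ℝ} {Vi Vj V W : Fin m → ℝ}
    (h : ∀ s : Fin m, superP m a b Vi Vj V s ≠ 0)
    (hW : ∀ s : Fin m, W s = V s * (superP m a b Vi Vj V (s + 1) / superP m a b Vi Vj V s)) :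
    W ∈ superpos m a b Vi Vj V := ⟨h, funext fun s => (hW s).symm⟩

theorem low_ext {m : ℕ} (V : Fin m → ℝ) (x : ℝ) : low (ext V x) = V := by
  funext s; simp [low, ext]

theorem quadExpr_ext (m : ℕ) (hm : 1 ≤ m) (a : ℝ) (W : Fin m → ℝ) (v : Fin (m + 1) → ℝ) (x : ℝ) :
    quadExpr m a (ext W x) v
      = (x - v 0) * ∏ s, W s - a * (v (Fin.last m) - W ⟨0, hm⟩) * ∏ s, low v s := by
  have h0 : ext W x 0 = W ⟨0, hm⟩ := by
    have : (0 : Fin (m + 1)) = (⟨0, hm⟩ : Fin m).castSucc := rfl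
    rw [this, ext, Fin.snoc_castSucc]
  rw [quadExpr, low_ext, h0]
  simp [ext]

theorem mem_quadResolved {m : ℕ} (hm : 1 ≤ m) {a : ℝ} {W : Fin m → ℝ} {v : Fin (m + 1) → ℝ} {x : ℝ}
    (hW : ∀ s, W s ≠ 0) (hx : quadExpr m a (ext W x) v = 0) : x ∈ quadResolved m a W v := by
  have hu : ∀ y, quadExpr m a (ext W y) v = 0 → y = x := by
    intro y hy
    have hP : ∏ s, W s ≠ 0 := Finset.prod_ne_zero_iff.2 fun s _ => hW s
    rw [quadExpr_ext m hm] at hx hy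
    have : (y - x) * ∏ s, W s = 0 := by linear_combination hy - hx
    linarith [(mul_eq_zero.1 this).resolve_right hP]
  have hE : ∃! x, quadExpr m a (ext W x) v = 0 := ⟨x, hx, hu⟩
  exact ⟨hE, hu _ hE.choose_spec.1⟩

theorem exists_quadExpr_eq_zero {m : ℕ} (hm : 1 ≤ m) (a : ℝ) {W : Fin m → ℝ} (v : Fin (m + 1) → ℝ)
    (hW : ∀ s, W s ≠ 0) : ∃ x, quadExpr m a (ext W x) v = 0 := by
  have hP : ∏ s, W s ≠ 0 := Finset.prod_ne_zero_iff.2 fun s _ => hW s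
  refine ⟨v 0 + a * (v (Fin.last m) - W ⟨0, hm⟩) * (∏ s, low v s) / ∏ s, W s, ?_⟩
  rw [quadExpr_ext m hm]
  field_simp
  ring

/-- The superposition formula in terms of the solutions of the bilinear equations. -/
theorem mem_superpos_of_isRatio {m : ℕ} {a b : ℝ} {V Vi Vj W : Fin m → ℝ} {f p q S : ℕ → ℝ}
    (hV : IsRatio V f) (hVi : IsRatio Vi fun k => f k * p k) (hVj : IsRatio Vj fun k => f k * q k)
    (hf : ∀ k, k ≤ m → f k ≠ 0) (hp : p 0 ≠ 0) (hq : q 0 ≠ 0)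
    (hW : IsRatio W fun k => f k * S k) (c : ℝ) (hc : c ≠ 0)
    (hS : ∀ k, k ≤ m → c * sol m a b p q k = S k) (hS0 : ∀ k < m, S k ≠ 0) :
    W ∈ superpos m a b Vi Vj V := by
  have hP : ∀ s, s ≤ m → superP m a b Vi Vj V s = f m ^ 2 / (c * (p 0 * q 0 * f 0 ^ 2)) * S s := by
    intro s hs
    have h0 := hf 0 (by omega)
    rw [← hS s hs]
    field_simp
    linear_combination superP_mul a b hV hVi hVj s hs
  have hk : f m ^ 2 / (c * (p 0 * q 0 * f 0 ^ 2)) ≠ 0 := by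
    have h0 := hf 0 (by omega)
    have h1 := hf m le_rfl
    positivity
  refine mem_superpos (fun s => ?_) fun s => ?_
  · rw [hP s s.2.le]
    exact mul_ne_zero hk (hS0 s s.2)
  · have h0 := hf s s.2.le
    have h1 := hS0 s s.2
    rw [hP s s.2.le, hP (s + 1) s.2, mul_div_mul_left _ _ hk]
    have e1 := hW s
    have e2 := hV s
    simp only at e1
    rw [← mul_div_assoc, eq_div_iff h1]
    apply mul_right_cancel₀ h0
    linear_combination e1 + S (s + 1) * (-e2)

theorem isRatio_mul_div {m : ℕ} {V : Fin m → ℝ} {f S : ℕ → ℝ} (hV : IsRatio V f)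
    (hS : ∀ k < m, S k ≠ 0) :
    IsRatio (fun s => V s * (S (s + 1) / S s)) fun k => f k * S k := by
  intro s
  have h0 := hS s s.2
  have h1 := hV s
  simp only
  rw [← h1]
  field_simp

theorem consistentIJ_of_ne_zero {ι : Type*} {m : ℕ} (hm : 1 ≤ m) (α : ι → ℝ) (i j : ι)
    (v : Fin (m + 1) → ℝ) (Vi Vj : Fin m → ℝ) (hv : ∀ s, v s ≠ 0) (hVi : ∀ s, Vi s ≠ 0)
    (hVj : ∀ s, Vj s ≠ 0) (hP : ∀ s ≤ m, superP m (α i) (α j) Vi Vj (low v) s ≠ 0) :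
    (dSK m α).ConsistentIJ i j v Vi Vj := by
  obtain ⟨vim, hvim⟩ := exists_quadExpr_eq_zero hm (α i) v hVi
  obtain ⟨vjm, hvjm⟩ := exists_quadExpr_eq_zero hm (α j) v hVj
  set a := α i
  set b := α j
  have hf : ∀ k, seqOf v k ≠ 0 := fun k => seqOf_ne_zero v k fun s _ => hv s
  have hrv := isRatio_seqOf v
  set f := seqOf v
  have hp : ∃ p : ℕ → ℝ, p 0 ≠ 0 ∧ p 1 ≠ 0 ∧ IsRatio (ext Vi vim) fun k => f k * p k := by
    -- Nothing excludes `vim = 0`, so the entry at `m + 1` may vanish; only the entries at `0` and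
    -- `1` are used as denominators.
    have hne : ∀ k ≤ m, seqOf (ext Vi vim) k ≠ 0 := fun k hk => seqOf_ne_zero _ k fun s hs => by
      have : s = (⟨s, by omega⟩ : Fin m).castSucc := rfl
      rw [this, ext, Fin.snoc_castSucc]
      exact hVi _
    refine ⟨fun k => seqOf (ext Vi vim) k / f k, div_ne_zero (hne 0 (by omega)) (hf _),
      div_ne_zero (hne 1 hm) (hf _), ?_⟩
    have : (fun k => f k * (seqOf (ext Vi vim) k / f k)) = seqOf (ext Vi vim) :=
      funext fun k => mul_div_cancel₀ _ (hf k)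
    rw [this]
    exact isRatio_seqOf _
  have hq : ∃ q : ℕ → ℝ, q 0 ≠ 0 ∧ q 1 ≠ 0 ∧ IsRatio (ext Vj vjm) fun k => f k * q k := by
    have hne : ∀ k ≤ m, seqOf (ext Vj vjm) k ≠ 0 := fun k hk => seqOf_ne_zero _ k fun s hs => by
      have : s = (⟨s, by omega⟩ : Fin m).castSucc := rfl
      rw [this, ext, Fin.snoc_castSucc]
      exact hVj _
    refine ⟨fun k => seqOf (ext Vj vjm) k / f k, div_ne_zero (hne 0 (by omega)) (hf _),
      div_ne_zero (hne 1 hm) (hf _), ?_⟩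
    have : (fun k => f k * (seqOf (ext Vj vjm) k / f k)) = seqOf (ext Vj vjm) :=
      funext fun k => mul_div_cancel₀ _ (hf k)
    rw [this]
    exact isRatio_seqOf _
  obtain ⟨p, hp0, hp1, hri⟩ := hp
  obtain ⟨q, hq0, hq1, hrj⟩ := hq
  have hri' : IsRatio Vi fun k => f k * p k := by simpa [low_ext] using hri.low
  have hrj' : IsRatio Vj fun k => f k * q k := by simpa [low_ext] using hrj.low
  have hEp : f 0 * f (m + 1) * (p (m + 1) - a * p 0) = f 1 * f m * (p m - a * p 1) := by
    have := quadExpr_mul a hrv hri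
    rw [hvim] at this
    linear_combination -this
  have hEq : f 0 * f (m + 1) * (q (m + 1) - b * q 0) = f 1 * f m * (q m - b * q 1) := by
    have := quadExpr_mul b hrv hrj
    rw [hvjm] at this
    linear_combination -this
  set S := sol m a b p q with hSdef
  have hS : ∀ k ≤ m, S k ≠ 0 := by
    intro k hk h0
    have := superP_mul a b hrv.low hri' hrj' k hk
    rw [← hSdef, h0, mul_zero] at this
    exact mul_ne_zero (hP k hk) (mul_ne_zero (mul_ne_zero hp0 hq0) (pow_ne_zero 2 (hf 0))) this
  -- One entry more than `V^{ij}` has: the last one is the common value `x = v^{ij}_m`.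
  set W : Fin (m + 1) → ℝ := fun s => v s * (S (s + 1) / S s) with hW
  have hrW : IsRatio W fun k => f k * S k := isRatio_mul_div hrv fun k hk => hS k (by omega)
  have hWext : ext (low W) (W (Fin.last m)) = W := by
    funext s
    induction s using Fin.lastCases with
    | last => simp [ext]
    | cast s => simp [ext, low]
  have hlow : ∀ s, low W s ≠ 0 := fun s =>
    mul_ne_zero (hv _) (div_ne_zero (hS _ s.2) (hS _ (by simp)))
  have hSij : low W ∈ superpos m a b Vi Vj (low v) :=
    mem_superpos_of_isRatio hrv.low hri' hrj' (fun k _ => hf k) hp0 hq0 hrW.low 1 one_ne_zero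
      (fun k _ => one_mul _) fun k hk => hS k hk.le
  have hSji : low W ∈ superpos m b a Vj Vi (low v) :=
    mem_superpos_of_isRatio hrv.low hrj' hri' (fun k _ => hf k) hq0 hp0 hrW.low (-1) (by simp)
      (fun k _ => by rw [sol_swap m a b p q]; ring) fun k hk => hS k hk.le
  refine ⟨vim, mem_quadResolved hm hVi hvim, vjm, mem_quadResolved hm hVj hvjm, low W, hSij, hSji,
    W (Fin.last m), mem_quadResolved hm hlow ?_, mem_quadResolved hm hlow ?_, ?_⟩
  · rw [hWext]
    have h1 := quadExpr_mul a hrj hrW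
    have h2 := sol_quad hEp hEq
    have h3 : f 0 * q 0 * (f 0 * S 0) ≠ 0 :=
      mul_ne_zero (mul_ne_zero (hf 0) hq0) (mul_ne_zero (hf 0) (hS 0 (by omega)))
    refine (mul_eq_zero.1 (h1.trans ?_)).resolve_right h3
    linear_combination h2
  · rw [hWext]
    have h1 := quadExpr_mul b hri hrW
    have h2 := sol_quad hEq hEp
    simp only [sol_swap m a b p q, ← hSdef] at h2
    have h3 : f 0 * p 0 * (f 0 * S 0) ≠ 0 :=
      mul_ne_zero (mul_ne_zero (hf 0) hp0) (mul_ne_zero (hf 0) (hS 0 (by omega)))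
    refine (mul_eq_zero.1 (h1.trans ?_)).resolve_right h3
    linear_combination -h2
  · rw [hWext]
    exact mem_superpos_of_isRatio (f := fun k => f (k + 1)) (p := fun k => p (k + 1))
      (q := fun k => q (k + 1)) (S := fun k => S (k + 1)) hrv.up hri.up hrj.up (fun k _ => hf _)
      hp1 hq1 hrW.up 1 one_ne_zero
      (fun k _ => (one_mul _).trans (sol_shift (mul_ne_zero (hf 0) (hf (m + 1))) hEp hEq k))
      fun k hk => hS _ hk

theorem sol_neg_left (m : ℕ) (a b : ℝ) (p q : ℕ → ℝ) (k : ℕ) :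
    sol m a b (fun k => -p k) q k = -sol m a b p q k := by
  have h : ∀ n, ∑ r ∈ Finset.range n, caso (fun k => -p k) q r
      = -∑ r ∈ Finset.range n, caso p q r := by
    intro n
    rw [← Finset.sum_neg_distrib]
    exact Finset.sum_congr rfl fun r _ => by simp only [caso]; ring
  simp only [sol, h]; ring

theorem sol_neg_right (m : ℕ) (a b : ℝ) (p q : ℕ → ℝ) (k : ℕ) :
    sol m a b p (fun k => -q k) k = -sol m a b p q k := by
  rw [sol_swap m b a, sol_neg_left, sol_swap m a b p q, neg_neg]

theorem consistentIJK_of_ne_zero {ι : Type*} {m : ℕ} (α : ι → ℝ) (i j k : ι)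
    {V Vi Vj Vk : Fin m → ℝ} {f p q h : ℕ → ℝ} (hf : ∀ k, f k ≠ 0) (hp : ∀ k, p k ≠ 0)
    (hq : ∀ k, q k ≠ 0) (hh : ∀ k, h k ≠ 0)
    (hrV : IsRatio V f) (hri : IsRatio Vi fun k => f k * p k)
    (hrj : IsRatio Vj fun k => f k * q k) (hrk : IsRatio Vk fun k => f k * h k)
    (hij : ∀ s ≤ m, sol m (α i) (α j) p q s ≠ 0) (hik : ∀ s ≤ m, sol m (α i) (α k) p h s ≠ 0)
    (hjk : ∀ s ≤ m, sol m (α j) (α k) q h s ≠ 0)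
    (hijk : ∀ s < m, sol₃ m (α i) (α j) (α k) p q h s ≠ 0) :
    (dSK m α).ConsistentIJK i j k V Vi Vj Vk := by
  set a := α i
  set b := α j
  set c := α k
  have hrij := isRatio_mul_div hrV fun s hs => hij s hs.le
  have hrik := isRatio_mul_div hrV fun s hs => hik s hs.le
  have hrjk := isRatio_mul_div hrV fun s hs => hjk s hs.le
  have hrijk := isRatio_mul_div hrV hijk
  have e : ∀ {W : Fin m → ℝ} {S r : ℕ → ℝ}, (∀ k, r k ≠ 0) → IsRatio W (fun k => f k * S k) →
      IsRatio W fun k => (f k * r k) * (S k / r k) := by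
    intro W S r hr hW
    have : (fun k => (f k * r k) * (S k / r k)) = fun k => f k * S k := by
      funext k
      have := hr k
      field_simp
    rwa [this]
  refine ⟨_, mem_superpos_of_isRatio hrV hri hrj (fun k _ => hf k) (hp 0) (hq 0) hrij 1 one_ne_zero
      (fun k _ => one_mul _) fun k hk => hij k hk.le,
    _, mem_superpos_of_isRatio hrV hri hrk (fun k _ => hf k) (hp 0) (hh 0) hrik 1 one_ne_zero
      (fun k _ => one_mul _) fun k hk => hik k hk.le,
    _, mem_superpos_of_isRatio hrV hrj hrk (fun k _ => hf k) (hq 0) (hh 0) hrjk 1 one_ne_zero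
      (fun k _ => one_mul _) fun k hk => hjk k hk.le,
    fun s => V s * (sol₃ m a b c p q h (s + 1) / sol₃ m a b c p q h s), ?_, ?_, ?_⟩
  · refine mem_superpos_of_isRatio hri (e hp hrij) (e hp hrik)
      (fun k _ => mul_ne_zero (hf k) (hp k)) (div_ne_zero (hij 0 (by omega)) (hp 0))
      (div_ne_zero (hik 0 (by omega)) (hp 0)) (e hp hrijk) 1 one_ne_zero (fun k _ => ?_)
      fun k hk => div_ne_zero (hijk k hk) (hp k)
    rw [one_mul, eq_div_iff (hp k), mul_comm]
    exact sol_sol m a b c hp k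
  · refine mem_superpos_of_isRatio hrj (e hq hrij) (e hq hrjk)
      (fun k _ => mul_ne_zero (hf k) (hq k)) (div_ne_zero (hij 0 (by omega)) (hq 0))
      (div_ne_zero (hjk 0 (by omega)) (hq 0)) (e hq hrijk) 1 one_ne_zero (fun k _ => ?_)
      fun k hk => div_ne_zero (hijk k hk) (hq k)
    have h1 := sol_sol m b a c (q := p) (h := h) hq k
    rw [sol₃_swap₁₂] at h1
    -- `V^{ij}` was built from the order `(i, j)`, while `sol_sol` over `f^j` uses `(j, i)`; this
    -- sign cancels the one from `sol₃_swap₁₂`.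
    simp only [sol_swap m a b p q, neg_div, sol_neg_left] at h1
    rw [one_mul, eq_div_iff (hq k)]
    linear_combination -h1
  · refine mem_superpos_of_isRatio hrk (e hh hrik) (e hh hrjk)
      (fun k _ => mul_ne_zero (hf k) (hh k)) (div_ne_zero (hik 0 (by omega)) (hh 0))
      (div_ne_zero (hjk 0 (by omega)) (hh 0)) (e hh hrijk) 1 one_ne_zero (fun k _ => ?_)
      fun k hk => div_ne_zero (hijk k hk) (hh k)
    have h1 := sol_sol m c a b (q := p) (h := q) hh k
    rw [sol₃_rotate] at h1
    simp only [sol_swap m a c p h, sol_swap m b c q h, neg_div, sol_neg_left,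
      sol_neg_right] at h1
    rw [one_mul, eq_div_iff (hh k)]
    linear_combination h1

/-! ### The denominators are nonzero polynomials. -/

/-- The polynomial that is proportional to `sol₃`. -/
noncomputable def superP₃ (m : ℕ) (a b c : ℝ) (Vi Vj Vk V : Fin m → ℝ) (s : ℕ) : ℝ :=
  (a * b - 1) * (a * c - 1) * (seqOf Vi s * superP m b c Vj Vk V s)
    - (a * b - 1) * (b * c - 1) * (seqOf Vj s * superP m a c Vi Vk V s)
    + (a * c - 1) * (b * c - 1) * (seqOf Vk s * superP m a b Vi Vj V s)

theorem superP₃_eq {m : ℕ} (a b c : ℝ) {V Vi Vj Vk : Fin m → ℝ} {f p q h : ℕ → ℝ}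
    (hV : IsRatio V f) (hVi : IsRatio Vi fun k => f k * p k) (hVj : IsRatio Vj fun k => f k * q k)
    (hVk : IsRatio Vk fun k => f k * h k) (hf0 : f 0 = 1) (hp0 : p 0 = 1) (hq0 : q 0 = 1)
    (hh0 : h 0 = 1) (s : ℕ) (hs : s ≤ m) :
    superP₃ m a b c Vi Vj Vk V s = f m ^ 2 * f s * sol₃ m a b c p q h s := by
  have e1 := superP_mul b c hV hVj hVk s hs
  have e2 := superP_mul a c hV hVi hVk s hs
  have e3 := superP_mul a b hV hVi hVj s hs
  have g1 := (isRatio_seqOf Vi).eq hVi (by simp [seqOf_zero, hf0, hp0]) s hs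
  have g2 := (isRatio_seqOf Vj).eq hVj (by simp [seqOf_zero, hf0, hq0]) s hs
  have g3 := (isRatio_seqOf Vk).eq hVk (by simp [seqOf_zero, hf0, hh0]) s hs
  simp only [hf0, hp0, hq0, hh0, one_pow, mul_one] at e1 e2 e3 g1 g2 g3
  rw [superP₃, sol₃, e1, e2, e3, g1, g2, g3]
  ring

/-- The indicator function of `{0, …, n}`. -/
noncomputable def stepSeq (n k : ℕ) : ℝ := if k ≤ n then 1 else 0

theorem stepSeq_zero (n : ℕ) : stepSeq n 0 = 1 := by simp [stepSeq]

theorem isRatio_stepSeq (m n : ℕ) :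
    IsRatio (fun s : Fin m => stepSeq n (s + 1)) fun k => 1 * stepSeq n k := by
  intro s
  simp only [stepSeq, one_mul]
  split_ifs <;> first | omega | simp

theorem isRatio_one (m : ℕ) : IsRatio (fun _ : Fin m => 1) fun _ => 1 := fun _ => by simp

/-- Step sequences are test points at which the Casorati determinant sits at a single place, so that
`sol` is explicit. -/
theorem sum_caso_stepSeq {n : ℕ} (hn : 1 ≤ n) (l : ℕ) :
    ∑ r ∈ Finset.range l, caso (stepSeq n) (stepSeq 0) r = if 0 < l then 1 else 0 := by
  have : ∀ r, caso (stepSeq n) (stepSeq 0) r = if r = 0 then 1 else 0 := by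
    intro r
    simp only [caso, stepSeq]
    split_ifs <;> first | omega | simp
  simp [this]

theorem sol_stepSeq_zero {m n : ℕ} (hm : 1 ≤ m) (hn : 1 ≤ n) (a b : ℝ) (s : ℕ) :
    sol m a b (stepSeq n) (stepSeq 0) s
      = 1 - b * stepSeq n m + (a * b - 1) * if 0 < s then 1 else 0 := by
  rw [sol, sum_caso_stepSeq hn, sum_caso_stepSeq hn, stepSeq_zero, stepSeq_zero,
    if_pos (show 0 < m from hm)]
  have : stepSeq 0 m = 0 := by simp [stepSeq]; omega
  rw [this]; ring

theorem sol_stepSeq_self (m n : ℕ) (a b : ℝ) (s : ℕ) :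
    sol m a b (stepSeq n) (stepSeq n) s = (a - b) * stepSeq n m := by
  simp [sol, caso, stepSeq_zero, mul_comm]; ring

/-- With `f = 1`, the tests `(p, q) = (stepSeq m, stepSeq 0)` and its swap give values whose sum is
`a - b`; they cannot both vanish. -/
theorem exists_superP_ne_zero {m : ℕ} (hm : 1 ≤ m) {a b : ℝ} (hab : a ≠ b) (s : ℕ) (hs : s ≤ m) :
    ∃ Vi Vj : Fin m → ℝ, superP m a b Vi Vj (fun _ => 1) s ≠ 0 := by
  by_contra! hc
  have key : ∀ n l, superP m a b (fun s : Fin m => stepSeq n (s + 1)) (fun s => stepSeq l (s + 1))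
      (fun _ => 1) s = sol m a b (stepSeq n) (stepSeq l) s := fun n l => by
    simpa [stepSeq_zero] using
      superP_mul a b (isRatio_one m) (isRatio_stepSeq m n) (isRatio_stepSeq m l) s hs
  have h1 := (key m 0).symm.trans (hc _ _)
  have h2 := (key 0 m).symm.trans (hc _ _)
  have hmm : stepSeq m m = 1 := by simp [stepSeq]
  rw [sol_stepSeq_zero hm hm, hmm] at h1
  rw [sol_swap m b a, sol_stepSeq_zero hm hm, hmm] at h2
  exact hab (by linear_combination h1 + h2)

/-- If one of `a b`, `a c`, `b c` is `1`, only one term of `superP₃` survives and the two-direction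
result applies. Otherwise step sequences are tested. -/
theorem exists_superP₃_ne_zero {m : ℕ} (hm : 1 ≤ m) {a b c : ℝ} (ha : a ≠ 0) (hb : b ≠ 0)
    (hc : c ≠ 0) (hab : a ≠ b) (hbc : b ≠ c) (hac : a ≠ c) (s : ℕ) (hs : s < m) :
    ∃ Vi Vj Vk : Fin m → ℝ, superP₃ m a b c Vi Vj Vk (fun _ => 1) s ≠ 0 := by
  have h1 : seqOf (fun _ : Fin m => 1) s ≠ 0 := seqOf_ne_zero _ _ fun _ _ => one_ne_zero
  have sub_ne : ∀ {x y z : ℝ}, x ≠ 0 → y ≠ z → x * y = 1 → x * z - 1 ≠ 0 := by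
    intro x y z hx hyz h h'
    exact hyz (mul_left_cancel₀ hx (by linear_combination h - h'))
  by_cases hab1 : a * b = 1
  · obtain ⟨Vi, Vj, h⟩ := exists_superP_ne_zero hm hab s hs.le
    refine ⟨Vi, Vj, fun _ => 1, ?_⟩
    have e1 := sub_ne ha hbc hab1
    have e2 := sub_ne hb hac ((mul_comm _ _).trans hab1)
    simpa [superP₃, hab1] using ⟨⟨e1, e2⟩, h1, h⟩
  by_cases hac1 : a * c = 1
  · obtain ⟨Vi, Vk, h⟩ := exists_superP_ne_zero hm hac s hs.le
    refine ⟨Vi, fun _ => 1, Vk, ?_⟩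
    have e1 := sub_ne ha hbc.symm hac1
    have e2 := sub_ne hc hab ((mul_comm _ _).trans hac1)
    rw [mul_comm] at e2
    simpa [superP₃, hac1] using ⟨⟨e1, e2⟩, h1, h⟩
  by_cases hbc1 : b * c = 1
  · obtain ⟨Vj, Vk, h⟩ := exists_superP_ne_zero hm hbc s hs.le
    refine ⟨fun _ => 1, Vj, Vk, ?_⟩
    have e1 := sub_ne hb hac.symm hbc1
    have e2 := sub_ne hc hab.symm ((mul_comm _ _).trans hbc1)
    rw [mul_comm] at e1 e2
    simpa [superP₃, hbc1] using ⟨⟨e1, e2⟩, h1, h⟩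
  replace hab1 := sub_ne_zero.2 hab1
  replace hac1 := sub_ne_zero.2 hac1
  replace hbc1 := sub_ne_zero.2 hbc1
  by_contra! hz
  have key : ∀ n l k, sol₃ m a b c (stepSeq n) (stepSeq l) (stepSeq k) s = 0 := fun n l k => by
    have := superP₃_eq a b c (isRatio_one m) (isRatio_stepSeq m n) (isRatio_stepSeq m l)
      (isRatio_stepSeq m k) rfl (stepSeq_zero n) (stepSeq_zero l) (stepSeq_zero k) s hs.le
    rw [hz] at this
    simpa using this.symm
  have h0m : stepSeq 0 m = 0 := by simp [stepSeq]; omega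
  rcases Nat.eq_zero_or_pos s with rfl | hs0
  -- Two tests are needed when `m = 1`: the first can vanish for `a = 1`, the second for `b = 1`.
  -- For `m > 1` the first suffices.
  · have k1 := key 1 0 0
    have k2 := key 0 1 0
    simp only [sol₃, sol_stepSeq_self, sol_swap m b a (stepSeq 1) (stepSeq 0), stepSeq_zero, h0m,
      sol_stepSeq_zero hm le_rfl, lt_irrefl, if_false] at k1 k2
    have k1' : (b * c - 1) * ((a * c - 1) * (1 - b * stepSeq 1 m)
        - (a * b - 1) * (1 - c * stepSeq 1 m)) = 0 := by linear_combination k1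
    have k2' : (a * c - 1) * ((a * b - 1) * (1 - c * stepSeq 1 m)
        - (b * c - 1) * (1 - a * stepSeq 1 m)) = 0 := by linear_combination k2
    have k1 := (mul_eq_zero.1 k1').resolve_left hbc1
    have k2 := (mul_eq_zero.1 k2').resolve_left hac1
    by_cases h : m ≤ 1
    · rw [stepSeq, if_pos h] at k1 k2
      have e1 : (b - c) * (1 - a) = 0 := by linear_combination k1
      have e2 : (a - c) * (1 - b) = 0 := by linear_combination -k2
      have e1 := (mul_eq_zero.1 e1).resolve_left (sub_ne_zero.2 hbc)
      have e2 := (mul_eq_zero.1 e2).resolve_left (sub_ne_zero.2 hac)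
      exact hab (by linear_combination e2 - e1)
    · rw [stepSeq, if_neg h] at k1
      have e1 : a * (c - b) = 0 := by linear_combination k1
      exact mul_ne_zero ha (sub_ne_zero.2 hbc.symm) e1
  -- Here `0 < s < m`, so `stepSeq (m - 1)` is `1` at `s` and `0` at `m`, while the third sequence
  -- vanishes at `s`.
  · have k1 := key (m - 1) (m - 1) 0
    have h2 : stepSeq (m - 1) m = 0 := by simp [stepSeq]; omega
    have h3 : stepSeq (m - 1) s = 1 := by simp [stepSeq]; omega
    rw [sol₃, sol_stepSeq_self, sol_stepSeq_zero hm (by omega), sol_stepSeq_zero hm (by omega), h2,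
      h3, if_pos hs0] at k1
    have e1 : c * (a * b - 1) * (a - b) = 0 := by linear_combination k1
    exact mul_ne_zero (mul_ne_zero hc hab1) (sub_ne_zero.2 hab) e1

/-! ### Multidimensional consistency for generic data. -/

theorem multidimensionallyConsistent_dSK {ι : Type*} (m : ℕ) (hm : 1 ≤ m) (α : ι → ℝ)
    (hα0 : ∀ i, α i ≠ 0) (hα : ∀ i j, i ≠ j → α i ≠ α j) :
    (dSK m α).MultidimensionallyConsistent where
  pair i j hij := by
    have h1 := generically_forall_coord_ne_zero
      fun s : Fin (m + 1) => (.inl s : Fin (m + 1) ⊕ Fin m ⊕ Fin m)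
    have h2 := generically_forall_coord_ne_zero
      fun s : Fin m => (.inr (.inl s) : Fin (m + 1) ⊕ Fin m ⊕ Fin m)
    have h3 := generically_forall_coord_ne_zero
      fun s : Fin m => (.inr (.inr s) : Fin (m + 1) ⊕ Fin m ⊕ Fin m)
    have h4 : Generically fun x : Fin (m + 1) ⊕ Fin m ⊕ Fin m → ℝ => ∀ s ∈ Finset.range (m + 1),
        superP m (α i) (α j) (fun s => x (.inr (.inl s))) (fun s => x (.inr (.inr s)))
          (low fun s => x (.inl s)) s ≠ 0 := by
      refine Generically.forall _ fun s hs => ?_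
      refine (IsPoly.superP _ _ (fun k => .coord _) (fun k => .coord _)
        (fun k => .coord _) s).generically_ne_zero ?_
      obtain ⟨Vi, Vj, h⟩ := exists_superP_ne_zero hm (hα i j hij) s (by simp at hs; omega)
      exact ⟨Sum.elim (fun _ => 1) (Sum.elim Vi Vj), h⟩
    refine (h1.and (h2.and (h3.and h4))).mono fun x hx => ?_
    exact consistentIJ_of_ne_zero hm α i j _ _ _ hx.1 hx.2.1 hx.2.2.1
      fun s hs => hx.2.2.2 s (by simp; omega)
  triple i j k hij hjk hik := by
    have h0 : ∀ e : Fin 4, Generically fun x : Fin 4 × Fin m → ℝ => ∀ s, x (e, s) ≠ 0 :=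
      fun e => generically_forall_coord_ne_zero fun s : Fin m => (e, s)
    have hP : ∀ (e e' : Fin 4) (a b : ℝ), a ≠ b → e ≠ e' → e ≠ 0 → e' ≠ 0 →
        Generically fun x : Fin 4 × Fin m → ℝ => ∀ s ∈ Finset.range (m + 1),
        superP m a b (fun s => x (e, s)) (fun s => x (e', s)) (fun s => x (0, s)) s ≠ 0 := by
      intro e e' a b hab hne he he'
      refine Generically.forall _ fun s hs => ?_
      refine (IsPoly.superP _ _ (fun k => .coord _) (fun k => .coord _)
        (fun k => .coord _) s).generically_ne_zero ?_
      obtain ⟨Vi, Vj, h⟩ := exists_superP_ne_zero hm hab s (by simp at hs; omega)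
      refine ⟨fun z => if z.1 = 0 then 1 else if z.1 = e then Vi z.2 else Vj z.2, ?_⟩
      simpa [he, he', hne.symm] using h
    have hT : Generically fun x : Fin 4 × Fin m → ℝ => ∀ s ∈ Finset.range m,
        superP₃ m (α i) (α j) (α k) (fun s => x (1, s)) (fun s => x (2, s)) (fun s => x (3, s))
          (fun s => x (0, s)) s ≠ 0 := by
      refine Generically.forall _ fun s hs => ?_
      have hs1 : ∀ e : Fin 4, IsPoly fun x : Fin 4 × Fin m → ℝ => seqOf (fun s => x (e, s)) s :=
        fun e => .seqOf (fun k => .coord _) s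
      have hs2 : ∀ (e e' : Fin 4) (a b : ℝ), IsPoly fun x : Fin 4 × Fin m → ℝ =>
          superP m a b (fun s => x (e, s)) (fun s => x (e', s)) (fun s => x (0, s)) s :=
        fun e e' a b => .superP _ _ (fun k => .coord _) (fun k => .coord _) (fun k => .coord _) s
      refine IsPoly.generically_ne_zero (.add (.sub (.mul (.const _) (.mul (hs1 1) (hs2 2 3 _ _)))
        (.mul (.const _) (.mul (hs1 2) (hs2 1 3 _ _))))
        (.mul (.const _) (.mul (hs1 3) (hs2 1 2 _ _)))) ?_
      obtain ⟨Vi, Vj, Vk, h⟩ := exists_superP₃_ne_zero hm (hα0 i) (hα0 j) (hα0 k) (hα i j hij)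
        (hα j k hjk) (hα i k hik) s (by simpa using hs)
      refine ⟨fun z => ![fun _ => 1, Vi, Vj, Vk] z.1 z.2, ?_⟩
      simpa [superP₃] using h
    refine (((h0 0).and ((h0 1).and ((h0 2).and (h0 3)))).and
      ((hP 1 2 (α i) (α j) (hα i j hij) (by decide) (by decide) (by decide)).and
      ((hP 1 3 (α i) (α k) (hα i k hik) (by decide) (by decide) (by decide)).and
      ((hP 2 3 (α j) (α k) (hα j k hjk) (by decide) (by decide) (by decide)).and hT)))).mono ?_
    rintro x ⟨⟨g0, g1, g2, g3⟩, gij, gik, gjk, gT⟩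
    have hf : ∀ e : Fin 4, (∀ s, x (e, s) ≠ 0) → ∀ k, seqOf (fun s => x (e, s)) k ≠ 0 :=
      fun e he k => seqOf_ne_zero _ _ fun s _ => he s
    have hr : ∀ e : Fin 4, IsRatio (fun s => x (e, s)) fun k => seqOf (fun s => x (0, s)) k *
        (seqOf (fun s => x (e, s)) k / seqOf (fun s => x (0, s)) k) := by
      intro e
      have : (fun k => seqOf (fun s => x (0, s)) k *
          (seqOf (fun s => x (e, s)) k / seqOf (fun s => x (0, s)) k))
          = seqOf (fun s => x (e, s)) := funext fun k => mul_div_cancel₀ _ (hf 0 g0 k)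
      rw [this]
      exact isRatio_seqOf _
    have hz : ∀ e : Fin 4, seqOf (fun s => x (e, s)) 0 / seqOf (fun s => x (0, s)) 0 = 1 :=
      fun e => by simp [seqOf_zero]
    have hS : ∀ (e e' : Fin 4) (a b : ℝ), (∀ s ∈ Finset.range (m + 1), superP m a b
        (fun s => x (e, s)) (fun s => x (e', s)) (fun s => x (0, s)) s ≠ 0) → ∀ s ≤ m, sol m a b
        (fun k => seqOf (fun s => x (e, s)) k / seqOf (fun s => x (0, s)) k)
        (fun k => seqOf (fun s => x (e', s)) k / seqOf (fun s => x (0, s)) k) s ≠ 0 := by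
      intro e e' a b h s hs h'
      have := superP_mul a b (isRatio_seqOf _) (hr e) (hr e') s hs
      rw [h', hz, hz, seqOf_zero] at this
      exact h s (by simp; omega) (by linear_combination this)
    refine consistentIJK_of_ne_zero α i j k (hf 0 g0) (fun k => div_ne_zero (hf 1 g1 k) (hf 0 g0 k))
      (fun k => div_ne_zero (hf 2 g2 k) (hf 0 g0 k)) (fun k => div_ne_zero (hf 3 g3 k) (hf 0 g0 k))
      (isRatio_seqOf _) (hr 1) (hr 2) (hr 3) (hS 1 2 _ _ gij) (hS 1 3 _ _ gik) (hS 2 3 _ _ gjk) ?_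
    intro s hs h'
    have := superP₃_eq (α i) (α j) (α k) (isRatio_seqOf _) (hr 1) (hr 2) (hr 3) (seqOf_zero _)
      (hz 1) (hz 2) (hz 3) s hs.le
    rw [h', mul_zero] at this
    exact gT s (by simpa using hs) this

/-! ### The lattice equation in terms of tau functions. -/

/-- `v` is the sequence of the ratios of consecutive entries of the nowhere vanishing `f`. -/
structure IsTau (f v : ℤ → ℝ) : Prop where
  ne_zero : ∀ n, f n ≠ 0
  eq_div : ∀ n, v n = f (n + 1) / f n

theorem exists_isTau {v : ℤ → ℝ} (hv : ∀ n, v n ≠ 0) : ∃ f, IsTau f v := by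
  refine ⟨fun n => (∏ k ∈ Finset.range n.toNat, v k)
    * (∏ k ∈ Finset.range (-n).toNat, v (-(k + 1)))⁻¹, fun n => ?_, fun n => ?_⟩
  · exact mul_ne_zero (Finset.prod_ne_zero_iff.2 fun _ _ => hv _)
      (inv_ne_zero (Finset.prod_ne_zero_iff.2 fun _ _ => hv _))
  · have hp : ∀ l : ℕ, ∏ k ∈ Finset.range l, v k ≠ 0 :=
      fun l => Finset.prod_ne_zero_iff.2 fun _ _ => hv _
    have hn : ∀ l : ℕ, ∏ k ∈ Finset.range l, v (-((k : ℤ) + 1)) ≠ 0 :=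
      fun l => Finset.prod_ne_zero_iff.2 fun _ _ => hv _
    rcases le_or_gt 0 n with h | h
    · lift n to ℕ using h
      have e1 : ((n : ℤ) + 1).toNat = n + 1 := by omega
      have e2 : (-((n : ℤ) + 1)).toNat = 0 := by omega
      have e3 : (-(n : ℤ)).toNat = 0 := by omega
      have := hp n
      simp only [e1, e2, e3, Int.toNat_natCast, Finset.prod_range_succ, Finset.range_zero,
        Finset.prod_empty]
      field_simp
    · obtain ⟨l, rfl⟩ : ∃ l : ℕ, n = -((l : ℤ) + 1) := ⟨(-n - 1).toNat, by omega⟩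
      have e1 : (-((l : ℤ) + 1) + 1).toNat = 0 := by omega
      have e2 : (-(-((l : ℤ) + 1) + 1)).toNat = l := by omega
      have e3 : (-((l : ℤ) + 1)).toNat = 0 := by omega
      have e4 : (- -((l : ℤ) + 1)).toNat = l + 1 := by omega
      have := hn l
      have := hv (-((l : ℤ) + 1))
      simp only [e1, e2, e3, e4, Finset.prod_range_succ, Finset.range_zero, Finset.prod_empty]
      field_simp

theorem IsTau.prod {f v : ℤ → ℝ} (h : IsTau f v) (n : ℤ) (l : ℕ) :
    ∏ k ∈ Finset.range l, v (n + k) = f (n + l) / f n := by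
  induction l with
  | zero => simp [h.ne_zero]
  | succ l ih =>
    rw [Finset.prod_range_succ, ih, h.eq_div]
    have h1 := h.ne_zero n
    have h2 := h.ne_zero (n + l)
    push_cast
    rw [← add_assoc]
    field_simp

theorem IsTau.prod_sub {f v : ℤ → ℝ} (h : IsTau f v) (n : ℤ) (l : ℕ) :
    ∏ k ∈ Finset.range l, v (n - (k + 1)) = f n / f (n - l) := by
  induction l with
  | zero => simp [h.ne_zero]
  | succ l ih =>
    rw [Finset.prod_range_succ, ih, h.eq_div]
    have h1 := h.ne_zero (n - l)
    have h2 := h.ne_zero (n - (l + 1))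
    push_cast
    rw [show n - ((l : ℤ) + 1) + 1 = n - l by ring]
    field_simp

/-- The logarithmic derivative of `v_n = f_{n+1} / f_n` in virtue of the lattice equation. -/
noncomputable def rate (m : ℕ) (f : ℤ → ℝ) (n : ℤ) : ℝ :=
  (f (n + 1 + m) * f (n - m) - f (n + m) * f (n + 1 - m)) / (f n * f (n + 1))

theorem IsTau.vLattice_eq {f v : ℤ → ℝ} (h : IsTau f v) (m : ℕ) (n : ℤ) :
    vLattice m v n = v n * rate m f n := by
  rw [vLattice, h.prod, h.prod_sub, h.eq_div, h.eq_div, h.eq_div, rate]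
  have h1 := h.ne_zero n
  have h2 := h.ne_zero (n + 1)
  have h3 := h.ne_zero (n + m)
  have h4 := h.ne_zero (n - m)
  rw [show n + (m : ℤ) + 1 = n + 1 + m by ring, show n - (m : ℤ) + 1 = n + 1 - m by ring]
  field_simp

theorem IsTau.hasDerivAt {f : ℤ → ℝ} {v : ℝ → ℤ → ℝ} {t : ℝ} (h : IsTau f (v t)) {m : ℕ}
    (hv : SolvesAt (vLattice m) v t) (n : ℤ) :
    HasDerivAt (fun τ => v τ n) (v t n * rate m f n) t := by
  rw [← h.vLattice_eq]
  exact hv n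

theorem IsTau.hasDerivAt_prod {f : ℤ → ℝ} {v : ℝ → ℤ → ℝ} {t : ℝ} (h : IsTau f (v t)) {m : ℕ}
    (hv : SolvesAt (vLattice m) v t) (n : ℤ) (l : ℕ) :
    HasDerivAt (fun τ => ∏ k ∈ Finset.range l, v τ (n + k))
      ((∏ k ∈ Finset.range l, v t (n + k)) * ∑ k ∈ Finset.range l, rate m f (n + k)) t := by
  induction l with
  | zero => simpa using hasDerivAt_const t (1 : ℝ)
  | succ l ih =>
    simp only [Finset.prod_range_succ, Finset.sum_range_succ]
    refine (ih.mul (h.hasDerivAt hv (n + l))).congr_deriv ?_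
    ring

/-- The bilinear form of the `m`-quad-equation, `v = f_1 / f`, `w = g_1 / g`. -/
def BilinearQuad (m : ℕ) (a : ℝ) (f g : ℤ → ℝ) : Prop :=
  ∀ n, f n * g (n + 1 + m) - f (n + 1) * g (n + m)
    = a * (f (n + 1 + m) * g n - f (n + m) * g (n + 1))

theorem quadExpr_window (m : ℕ) (a : ℝ) (w v : ℤ → ℝ) (n : ℤ) :
    quadExpr m a (window (m + 1) w n) (window (m + 1) v n)
      = (w (n + m) - v n) * ∏ k ∈ Finset.range m, w (n + k)
        - a * (v (n + m) - w n) * ∏ k ∈ Finset.range m, v (n + k) := by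
  simp [quadExpr, low, window, Finset.prod_range]

theorem QuadRelated.bilinearQuad {m : ℕ} {a : ℝ} {f g v w : ℤ → ℝ} (hf : IsTau f v)
    (hg : IsTau g w) (h : QuadRelated m a v w) : BilinearQuad m a f g := by
  intro n
  have h1 := h.2.2 n
  rw [quadExpr_window, hf.prod, hg.prod, hf.eq_div, hf.eq_div, hg.eq_div, hg.eq_div] at h1
  have e1 := hf.ne_zero n
  have e2 := hg.ne_zero n
  have e3 := hf.ne_zero (n + m)
  have e4 := hg.ne_zero (n + m)
  rw [show n + (m : ℤ) + 1 = n + 1 + m by ring] at h1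
  field_simp at h1
  linear_combination h1

/-- The potential of the difference of the logarithmic derivatives of `w` and `v`. -/
noncomputable def pot (m : ℕ) (a : ℝ) (f g : ℤ → ℝ) (n : ℤ) : ℝ :=
  (a * (f (n + m) * g (n - m)) - a⁻¹ * (f (n - m) * g (n + m))) / (f n * g n)

/-- The difference of the two rates is a total difference by the bilinear equation at `n` and at `n
- m`. -/
theorem rate_sub_rate {m : ℕ} {a : ℝ} (ha : a ≠ 0) {f g : ℤ → ℝ} (hf : ∀ n, f n ≠ 0)
    (hg : ∀ n, g n ≠ 0) (h : BilinearQuad m a f g) (n : ℤ) :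
    rate m g n - rate m f n = pot m a f g (n + 1) - pot m a f g n := by
  have h0 := h n
  have h1 := h (n - m)
  rw [show n - (m : ℤ) + 1 + m = n + 1 by ring, show n - (m : ℤ) + m = n by ring,
    show n - (m : ℤ) + 1 = n + 1 - m by ring] at h1
  simp only [rate, pot]
  have e1 := hf n
  have e2 := hf (n + 1)
  have e3 := hg n
  have e4 := hg (n + 1)
  field_simp
  linear_combination (a * f (n + 1) * g (n - m) + f (n + 1 - m) * g n) * h0
    - (f (n + 1) * g (n + m) + a * g n * f (n + 1 + m)) * h1

theorem sum_rate_sub {m : ℕ} {a : ℝ} (ha : a ≠ 0) {f g : ℤ → ℝ} (hf : ∀ n, f n ≠ 0)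
    (hg : ∀ n, g n ≠ 0) (h : BilinearQuad m a f g) (n : ℤ) (l : ℕ) :
    ∑ k ∈ Finset.range l, rate m g (n + k) - ∑ k ∈ Finset.range l, rate m f (n + k)
      = pot m a f g (n + l) - pot m a f g n := by
  induction l with
  | zero => simp
  | succ l ih =>
    have := rate_sub_rate ha hf hg h (n + l)
    rw [Finset.sum_range_succ, Finset.sum_range_succ]
    push_cast
    rw [← add_assoc]
    linear_combination ih + this

/-- With `bilinear_lower`, this is half of the differentiated bilinear equation: here the equation
is used at `n` and `n + m`, there at `n` and `n - m`. -/
theorem bilinear_upper {m : ℕ} {a : ℝ} (ha : a ≠ 0) {f g : ℤ → ℝ} (hf : ∀ n, f n ≠ 0)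
    (hg : ∀ n, g n ≠ 0) (h : BilinearQuad m a f g) (n : ℤ) :
    rate m f (n + m) * (f (n + 1) * g (n + m) - a * f (n + m) * g (n + 1))
      + f n * g (n + 1 + m) * pot m a f g (n + 1 + m) - f (n + 1) * g (n + m) * pot m a f g (n + m)
      = 0 := by
  have h0 := h n
  have h1 := h (n + m)
  simp only [rate, pot, show n + (m : ℤ) + 1 = n + 1 + m by ring, add_sub_cancel_right] at *
  have e1 := hf (n + m)
  have e2 := hf (n + 1 + m)
  have e3 := hg (n + m)
  have e4 := hg (n + 1 + m)
  field_simp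
  linear_combination a * f (n + m + m) * f (n + 1) * h0 - f n * f (n + 1) * h1

theorem bilinear_lower {m : ℕ} {a : ℝ} (ha : a ≠ 0) {f g : ℤ → ℝ} (hf : ∀ n, f n ≠ 0)
    (hg : ∀ n, g n ≠ 0) (h : BilinearQuad m a f g) (n : ℤ) :
    -rate m f n * (f (n + 1) * g (n + m) - a * f (n + m) * g (n + 1))
      + a * f (n + m) * g (n + 1) * pot m a f g (n + 1) - a * f (n + 1 + m) * g n * pot m a f g n
      = 0 := by
  have h0 := h n
  have h1 := h (n - m)
  rw [show n - (m : ℤ) + 1 + m = n + 1 by ring, show n - (m : ℤ) + m = n by ring,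
    show n - (m : ℤ) + 1 = n + 1 - m by ring] at h1
  simp only [rate, pot]
  have e1 := hf n
  have e2 := hf (n + 1)
  have e3 := hg n
  have e4 := hg (n + 1)
  field_simp
  linear_combination -f (n + 1 - m) * f (n + m) * h0 + a * f (n + m) * f (n + 1 + m) * h1

theorem hasDerivAt_quadExpr {m : ℕ} {a : ℝ} (ha : a ≠ 0) {v w : ℝ → ℤ → ℝ} {t : ℝ}
    (h : QuadRelated m a (v t) (w t)) (hv : SolvesAt (vLattice m) v t)
    (hw : SolvesAt (vLattice m) w t) (n : ℤ) :
    HasDerivAt (fun τ => quadExpr m a (window (m + 1) (w τ) n) (window (m + 1) (v τ) n)) 0 t := by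
  obtain ⟨f, hf⟩ := exists_isTau h.1
  obtain ⟨g, hg⟩ := exists_isTau h.2.1
  have hB := h.bilinearQuad hf hg
  have h1 := h.2.2 n
  simp only [quadExpr_window] at h1 ⊢
  refine ((((hg.hasDerivAt hw (n + m)).sub (hf.hasDerivAt hv n)).mul
    (hg.hasDerivAt_prod hw n m)).sub ((((hf.hasDerivAt hv (n + m)).sub
    (hg.hasDerivAt hw n)).const_mul a).mul (hf.hasDerivAt_prod hv n m))).congr_deriv ?_
  have k1 := sum_rate_sub ha hf.ne_zero hg.ne_zero hB n m
  have k2 := rate_sub_rate ha hf.ne_zero hg.ne_zero hB n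
  have k3 := rate_sub_rate ha hf.ne_zero hg.ne_zero hB (n + m)
  have k4 := bilinear_upper ha hf.ne_zero hg.ne_zero hB n
  have k5 := bilinear_lower ha hf.ne_zero hg.ne_zero hB n
  have h0 := hB n
  have e1 := hf.ne_zero n
  have e2 := hg.ne_zero n
  have e3 := hf.ne_zero (n + m)
  have e4 := hg.ne_zero (n + m)
  -- All rates of `w` are eliminated in favour of those of `v` and of `pot`. What remains is the sum
  -- of the two halves `k4`, `k5` and a multiple of the equation itself.
  rw [sub_eq_iff_eq_add] at k1 k2 k3
  rw [k1, k2, k3]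
  simp only [Pi.sub_apply]
  rw [hf.prod, hg.prod, hf.eq_div, hf.eq_div, hg.eq_div, hg.eq_div] at h1 ⊢
  simp only [show n + (m : ℤ) + 1 = n + 1 + m by ring] at *
  generalize pot m a f g (n + 1 + m) = G₃ at *
  generalize pot m a f g (n + m) = G₂ at *
  generalize pot m a f g (n + 1) = G₁ at *
  generalize pot m a f g n = G₀ at *
  generalize rate m f (n + m) = R₂ at *
  generalize rate m f n = R₀ at *
  generalize ∑ k ∈ Finset.range m, rate m f (n + k) = Q₀ at *
  field_simp
  linear_combination k4 + k5 + (R₂ - G₀ + Q₀) * h0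

theorem solvesAt_uLattice {m : ℕ} (hm : 1 ≤ m) {v : ℝ → ℤ → ℝ} {t : ℝ} (h0 : ∀ n, v t n ≠ 0)
    (hv : SolvesAt (vLattice m) v t) :
    SolvesAt (uLattice m) (fun τ n => v τ (n + m) / v τ n) t := by
  obtain ⟨f, hf⟩ := exists_isTau h0
  -- The variable `u` has its own tau function `f_m / f`, so its products telescope too.
  have hu : IsTau (fun n => f (n + m) / f n) fun n => v t (n + m) / v t n := by
    refine ⟨fun n => div_ne_zero (hf.ne_zero _) (hf.ne_zero _), fun n => ?_⟩
    rw [hf.eq_div, hf.eq_div, show n + (m : ℤ) + 1 = n + 1 + m by ring]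
    have e1 := hf.ne_zero n
    have e2 := hf.ne_zero (n + 1)
    have e3 := hf.ne_zero (n + m)
    field_simp
  intro n
  refine ((hf.hasDerivAt hv (n + m)).div (hf.hasDerivAt hv n) (h0 n)).congr_deriv ?_
  have p1 : ∀ l : ℕ, ∏ k ∈ Finset.range l, v t (n + (k + 1) + m) / v t (n + (k + 1))
      = f (n + 1 + l + m) / f (n + 1 + l) / (f (n + 1 + m) / f (n + 1)) := fun l => by
    rw [← hu.prod]
    exact Finset.prod_congr rfl fun k _ => by rw [show n + ((k : ℤ) + 1) = n + 1 + k by ring]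
  simp only [uLattice, p1, hu.prod_sub]
  push_cast [Nat.cast_sub hm]
  rw [show n + 1 + ((m : ℤ) - 1) = n + m by ring, show n - ((m : ℤ) - 1) = n + 1 - m by ring,
    hf.eq_div, hf.eq_div]
  simp only [rate, show n + (m : ℤ) + 1 = n + 1 + m by ring, add_sub_cancel_right,
    sub_add_cancel]
  have e1 := hf.ne_zero n
  have e2 := hf.ne_zero (n + 1)
  have e3 := hf.ne_zero (n + m)
  have e4 := hf.ne_zero (n + 1 + m)
  have e5 := hf.ne_zero (n - m)
  have e6 := hf.ne_zero (n + 1 - m)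
  field_simp
  ring

/-! ### Superposition and the lattice equation. -/

theorem IsTau.isRatio_window {f v : ℤ → ℝ} (h : IsTau f v) (l : ℕ) (n : ℤ) :
    IsRatio (window l v n) fun k => f (n + k) := by
  intro s
  have := h.ne_zero (n + (s : ℕ))
  simp only [window, h.eq_div]
  push_cast
  rw [add_assoc]
  field_simp

/-- The global form of `sol`, on the whole lattice. -/
noncomputable def lsol (m : ℕ) (a b : ℝ) (f g h : ℤ → ℝ) (n : ℤ) : ℝ :=
  sol m a b (fun k => g (n + k) / f (n + k)) (fun k => h (n + k) / f (n + k)) 0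

section BilinearQuad

variable {m : ℕ} {a b : ℝ} {f g h : ℤ → ℝ}

theorem BilinearQuad.ratio (hf : ∀ n, f n ≠ 0) (hB : BilinearQuad m a f g) (n : ℤ) :
    f n * f (n + 1 + m) * (g (n + 1 + m) / f (n + 1 + m) - a * (g n / f n))
      = f (n + 1) * f (n + m) * (g (n + m) / f (n + m) - a * (g (n + 1) / f (n + 1))) := by
  have h0 := hB n
  have e1 := hf n
  have e2 := hf (n + 1)
  have e3 := hf (n + m)
  have e4 := hf (n + 1 + m)
  field_simp
  linear_combination h0

/-- By shift covariance, the base point and the index enter only through their sum. -/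
theorem sol_eq_lsol (hf : ∀ n, f n ≠ 0) (hg : BilinearQuad m a f g) (hh : BilinearQuad m b f h)
    (n : ℤ) (s : ℕ) :
    sol m a b (fun k => g (n + k) / f (n + k)) (fun k => h (n + k) / f (n + k)) s
      = lsol m a b f g h (n + s) := by
  induction s generalizing n with
  | zero => simp [lsol]
  | succ s ih =>
    have e : ∀ k : ℕ, n + ((k + 1 : ℕ) : ℤ) = n + 1 + k := fun k => by push_cast; ring
    have h1 := hg.ratio hf n
    have h2 := hh.ratio hf n
    rw [← sol_shift (e := f n * f (n + 1 + m)) (d := f (n + 1) * f (n + m))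
      (mul_ne_zero (hf _) (hf _)) (by simp only [e]; simpa using h1)
      (by simp only [e]; simpa using h2)]
    simp only [e]
    exact ih (n + 1)

/-- Compare the indices `0` and `m` at the same base point: both values involve the same full
Casorati sum, with weights `1` and `a b`. -/
theorem lsol_add (hf : ∀ n, f n ≠ 0) (hg : BilinearQuad m a f g) (hh : BilinearQuad m b f h)
    (n : ℤ) : lsol m a b f g h (n + m) = a * b * lsol m a b f g h n + (1 - a * b)
      * ((a * h (n + m) * g n - b * g (n + m) * h n) / (f (n + m) * f n)) := by
  rw [← sol_eq_lsol hf hg hh, lsol, sol, sol]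
  have e1 := hf n
  have e2 := hf (n + m)
  simp only [Finset.range_zero, Finset.sum_empty, Nat.cast_zero, add_zero]
  field_simp
  ring

/-- The logarithmic derivative of `lsol` multiplied by `lsol / (a * b - 1)`. -/
noncomputable def flux (m : ℕ) (a b : ℝ) (f g h : ℤ → ℝ) (n : ℤ) : ℝ :=
  (a / b * (h (n + m) * g (n - m)) - b / a * (g (n + m) * h (n - m))) / f n ^ 2

/-- Along the path from `v` through `v^j` to `v^{ij}` potentials add up. Eliminating `lsol` at `n +
m` and `n - m` by `lsol_add` leaves a multiple of `flux / lsol`. -/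
theorem pot_add_pot (ha : a ≠ 0) (hb : b ≠ 0) (hf : ∀ n, f n ≠ 0) (hh0 : ∀ n, h n ≠ 0)
    (hS : ∀ n, lsol m a b f g h n ≠ 0)
    (hg : BilinearQuad m a f g) (hh : BilinearQuad m b f h) (n : ℤ) :
    pot m a h (fun n => f n * lsol m a b f g h n) n + pot m b f h n
      = (a * b - 1) * flux m a b f g h n / lsol m a b f g h n := by
  have h1 := lsol_add hf hg hh n
  have h2 := lsol_add hf hg hh (n - m)
  rw [sub_add_cancel] at h2
  have e0 := hS n
  have e1 := hf n
  have e2 := hf (n + m)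
  have e3 := hf (n - m)
  have e4 := hh0 n
  simp only [pot, flux]
  rw [h1]
  generalize lsol m a b f g h (n - m) = S₁ at *
  generalize lsol m a b f g h n = S at *
  have h3 : S₁ = (S - (1 - a * b)
      * ((a * h n * g (n - m) - b * g n * h (n - m)) / (f n * f (n - m)))) / (a * b) := by
    rw [h2]
    field_simp
    ring
  rw [h3]
  field_simp
  ring

theorem caso_pot (ha : a ≠ 0) (hb : b ≠ 0) (hf : ∀ n, f n ≠ 0) (hg0 : ∀ n, g n ≠ 0)
    (hh0 : ∀ n, h n ≠ 0) (hg : BilinearQuad m a f g) (hh : BilinearQuad m b f h) (n : ℤ) :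
    g (n + 1) / f (n + 1) * (h n / f n) * (pot m a f g (n + 1) + pot m b f h n)
      - h (n + 1) / f (n + 1) * (g n / f n) * (pot m b f h (n + 1) + pot m a f g n)
      = flux m a b f g h (n + 1) - flux m a b f g h n := by
  have k1 := hg n
  have k2 := hh n
  have k3 := hg (n - m)
  have k4 := hh (n - m)
  rw [show n - (m : ℤ) + 1 + m = n + 1 by ring, show n - (m : ℤ) + m = n by ring,
    show n - (m : ℤ) + 1 = n + 1 - m by ring] at k3 k4
  simp only [pot, flux]
  have e1 := hf n
  have e2 := hf (n + 1)
  have e3 := hg0 n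
  have e4 := hg0 (n + 1)
  have e5 := hh0 n
  have e6 := hh0 (n + 1)
  field_simp
  linear_combination b * (b * f n * h (n + 1 - m) - f (n + 1 - m) * h n) * k1
    + a * (f (n + 1 - m) * g n - a * f n * g (n + 1 - m)) * k2
    + (b * f (n + 1) * g (n + m) - a * b * f (n + m) * g (n + 1)) * k4
    + (a * b * f (n + m) * h (n + 1) - a * f (n + 1) * h (n + m)) * k3

theorem boundary_pot (ha : a ≠ 0) (hb : b ≠ 0) (hf : ∀ n, f n ≠ 0) (hg0 : ∀ n, g n ≠ 0)
    (hh0 : ∀ n, h n ≠ 0) (n : ℤ) :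
    a * (h (n + m) / f (n + m)) * (g n / f n) * (pot m b f h (n + m) + pot m a f g n)
      - b * (g (n + m) / f (n + m)) * (h n / f n) * (pot m a f g (n + m) + pot m b f h n)
      = a * b * flux m a b f g h n - flux m a b f g h (n + m) := by
  simp only [pot, flux, add_sub_cancel_right]
  have e1 := hf n
  have e2 := hf (n + m)
  have e3 := hg0 n
  have e4 := hg0 (n + m)
  have e5 := hh0 n
  have e6 := hh0 (n + m)
  field_simp
  ring

end BilinearQuad

/-- The Casorati sums telescope to differences of `l`, and the boundary term supplies `a b l_0 -
l_m`, so only `(a b - 1) l_s` survives. The constants `c`, `d` account for the normalization of `P`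
and `Q`. -/
theorem hasDerivAt_sol {m : ℕ} {a b c d t : ℝ} {P Q : ℝ → ℕ → ℝ} {x y l : ℕ → ℝ}
    (hP : ∀ k, HasDerivAt (fun τ => P τ k) (P t k * (x k - c)) t)
    (hQ : ∀ k, HasDerivAt (fun τ => Q τ k) (Q t k * (y k - d)) t)
    (h₁ : ∀ r, P t (r + 1) * Q t r * (x (r + 1) + y r) - Q t (r + 1) * P t r * (y (r + 1) + x r)
      = l (r + 1) - l r)
    (h₂ : a * Q t m * P t 0 * (y m + x 0) - b * P t m * Q t 0 * (x m + y 0)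
      = a * b * l 0 - l m) (s : ℕ) :
    HasDerivAt (fun τ => sol m a b (P τ) (Q τ) s)
      ((a * b - 1) * l s - (c + d) * sol m a b (P t) (Q t) s) t := by
  have hc : ∀ r, HasDerivAt (fun τ => caso (P τ) (Q τ) r)
      (l (r + 1) - l r - (c + d) * caso (P t) (Q t) r) t := by
    intro r
    refine (((hP (r + 1)).mul (hQ r)).sub ((hQ (r + 1)).mul (hP r))).congr_deriv ?_
    rw [caso]
    linear_combination h₁ r
  have hs : ∀ n, HasDerivAt (fun τ => ∑ r ∈ Finset.range n, caso (P τ) (Q τ) r)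
      (l n - l 0 - (c + d) * ∑ r ∈ Finset.range n, caso (P t) (Q t) r) t := by
    intro n
    refine (HasDerivAt.fun_sum fun r _ => hc r).congr_deriv ?_
    rw [Finset.sum_sub_distrib, Finset.sum_range_sub, Finset.mul_sum]
  refine ((((((hQ m).const_mul a).mul (hP 0)).sub (((hP m).const_mul b).mul (hQ 0))).add
    (hs m)).add ((hs s).const_mul (a * b - 1))).congr_deriv ?_
  rw [sol]
  linear_combination h₂

theorem hasDerivAt_superpos {m : ℕ} (hm : 1 ≤ m) {a b : ℝ} (ha : a ≠ 0) (hb : b ≠ 0)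
    {v vi vj vij : ℝ → ℤ → ℝ} {t : ℝ} (hi : QuadRelated m a (v t) (vi t))
    (hj : QuadRelated m b (v t) (vj t)) (hij : QuadRelated m a (vj t) (vij t))
    (hR : ∀ n : ℤ, window m (vij t) n ∈
      superpos m a b (window m (vi t) n) (window m (vj t) n) (window m (v t) n))
    (hv : SolvesAt (vLattice m) v t) (hvi : SolvesAt (vLattice m) vi t)
    (hvj : SolvesAt (vLattice m) vj t) (hvij : SolvesAt (vLattice m) vij t) (n : ℤ) (s : Fin m) :
    HasDerivAt (fun τ => window m (vij τ) n s - window m (v τ) n s *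
        (superP m a b (window m (vi τ) n) (window m (vj τ) n) (window m (v τ) n) (s + 1) /
          superP m a b (window m (vi τ) n) (window m (vj τ) n) (window m (v τ) n) s)) 0 t := by
  obtain ⟨f, hf⟩ := exists_isTau hi.1
  obtain ⟨g, hg⟩ := exists_isTau hi.2.1
  obtain ⟨h, hh⟩ := exists_isTau hj.2.1
  have hBi := hi.bilinearQuad hf hg
  have hBj := hj.bilinearQuad hf hh
  have hp0 : ∀ n, g n / f n ≠ 0 := fun n => div_ne_zero (hg.ne_zero n) (hf.ne_zero n)
  have hq0 : ∀ n, h n / f n ≠ 0 := fun n => div_ne_zero (hh.ne_zero n) (hf.ne_zero n)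
  have hmul : ∀ {w : ℤ → ℝ} {g : ℤ → ℝ}, IsTau g w → ∀ n : ℤ, IsRatio (window m w n)
      fun k => f (n + k) * (g (n + k) / f (n + k)) := by
    intro w g hg n
    have : (fun k : ℕ => f (n + k) * (g (n + k) / f (n + k))) = fun k : ℕ => g (n + k) :=
      funext fun k => mul_div_cancel₀ _ (hf.ne_zero _)
    rw [this]
    exact hg.isRatio_window m n
  have hPS : ∀ (n : ℤ) (s : ℕ), s ≤ m →
      superP m a b (window m (vi t) n) (window m (vj t) n) (window m (v t) n) s
        * (g n / f n * (h n / f n) * f n ^ 2)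
        = f (n + m) ^ 2 * lsol m a b f g h (n + s) := by
    intro n s hs
    rw [← sol_eq_lsol hf.ne_zero hBi hBj]
    simpa using superP_mul a b (hf.isRatio_window m n) (hmul hg n) (hmul hh n) s hs
  have hk : ∀ n, g n / f n * (h n / f n) * f n ^ 2 ≠ 0 := fun n =>
    mul_ne_zero (mul_ne_zero (hp0 n) (hq0 n)) (pow_ne_zero 2 (hf.ne_zero n))
  have hS : ∀ n, lsol m a b f g h n ≠ 0 := by
    intro n h0
    have h1 := hPS n 0 (by omega)
    rw [Nat.cast_zero, add_zero, h0, mul_zero] at h1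
    exact mul_ne_zero ((hR n).1 ⟨0, hm⟩) (hk n) h1
  have hratio : ∀ (n : ℤ) (s : ℕ), s < m →
      superP m a b (window m (vi t) n) (window m (vj t) n) (window m (v t) n) (s + 1)
        / superP m a b (window m (vi t) n) (window m (vj t) n) (window m (v t) n) s
        = lsol m a b f g h (n + s + 1) / lsol m a b f g h (n + s) := by
    intro n s hs
    have h1 := hPS n s hs.le
    have h2 := hPS n (s + 1) hs
    rw [← mul_div_mul_right _ _ (hk n), h1, h2,
      mul_div_mul_left _ _ (pow_ne_zero 2 (hf.ne_zero _))]
    push_cast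
    rw [add_assoc n]
  -- Formula (2) with `s = 0`, taken at every `n`, identifies `f * lsol` as a tau function of
  -- `v^{ij}`.
  have hijτ : IsTau (fun n => f n * lsol m a b f g h n) (vij t) := by
    refine ⟨fun n => mul_ne_zero (hf.ne_zero n) (hS n), fun n => ?_⟩
    have h1 := congrFun (hR n).2 ⟨0, hm⟩
    have h2 := hratio n 0 hm
    simp only [superpos, window, Nat.cast_zero, add_zero] at h1 h2
    rw [← h1, mul_div_mul_comm, ← hf.eq_div]
    exact congrArg _ h2
  have hBij := hij.bilinearQuad hh hijτ
  have hrate : ∀ n, rate m (fun n => f n * lsol m a b f g h n) n - rate m f n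
      = (a * b - 1) * flux m a b f g h (n + 1) / lsol m a b f g h (n + 1)
        - (a * b - 1) * flux m a b f g h n / lsol m a b f g h n := by
    intro n
    rw [← pot_add_pot ha hb hf.ne_zero hh.ne_zero hS hBi hBj,
      ← pot_add_pot ha hb hf.ne_zero hh.ne_zero hS hBi hBj]
    linear_combination rate_sub_rate ha hh.ne_zero hijτ.ne_zero hBij n
      + rate_sub_rate hb hf.ne_zero hh.ne_zero hBj n
  -- Tau functions are chosen only at the time `t`. Nearby, the ratio is rebuilt from products
  -- starting at `n`, with the initial value `g n / f n` frozen; hence its logarithmic derivative is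
  -- `pot` at `n + k` minus `pot` at `n`.
  let P : (ℝ → ℤ → ℝ) → (ℤ → ℝ) → ℝ → ℕ → ℝ := fun w g τ k => g n / f n *
    ((∏ r ∈ Finset.range k, w τ (n + r)) / ∏ r ∈ Finset.range k, v τ (n + r))
  have hPt : ∀ {w : ℝ → ℤ → ℝ} {g : ℤ → ℝ}, IsTau g (w t) → ∀ k,
      P w g t k = g (n + k) / f (n + k) := by
    intro w g hg k
    have e1 := hf.ne_zero n
    have e2 := hf.ne_zero (n + k)
    have e3 := hg.ne_zero n
    simp only [P, hg.prod, hf.prod]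
    field_simp
  have hPd : ∀ {w : ℝ → ℤ → ℝ} {g : ℤ → ℝ} {a : ℝ}, a ≠ 0 → IsTau g (w t) →
      BilinearQuad m a f g → SolvesAt (vLattice m) w t → ∀ k, HasDerivAt (fun τ => P w g τ k)
        (P w g t k * (pot m a f g (n + k) - pot m a f g n)) t := by
    intro w g a ha hg hB hw k
    have e0 : ∏ r ∈ Finset.range k, v t (n + r) ≠ 0 :=
      Finset.prod_ne_zero_iff.2 fun r _ => hi.1 _
    refine (((hg.hasDerivAt_prod hw n k).div (hf.hasDerivAt_prod hv n k) e0).const_mul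
      (g n / f n)).congr_deriv ?_
    rw [← sum_rate_sub ha hf.ne_zero hg.ne_zero hB]
    simp only [P]
    have e1 := hf.ne_zero n
    field_simp
  have hsol : ∀ s, HasDerivAt (fun τ => sol m a b (P vi g τ) (P vj h τ) s)
      ((a * b - 1) * flux m a b f g h (n + s)
        - (pot m a f g n + pot m b f h n) * sol m a b (P vi g t) (P vj h t) s) t := by
    refine hasDerivAt_sol (x := fun k => pot m a f g (n + k)) (y := fun k => pot m b f h (n + k))
      (l := fun k => flux m a b f g h (n + k)) (hPd ha hg hBi hvi) (hPd hb hh hBj hvj) ?_ ?_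
    · intro r
      have := caso_pot ha hb hf.ne_zero hg.ne_zero hh.ne_zero hBi hBj (n + r)
      rw [hPt hg, hPt hg, hPt hh, hPt hh]
      push_cast
      rw [← add_assoc]
      exact this
    · have := boundary_pot (m := m) ha hb hf.ne_zero hg.ne_zero hh.ne_zero n
      rw [hPt hg, hPt hg, hPt hh, hPt hh]
      simpa using this
  have hsolt : ∀ s : ℕ, sol m a b (P vi g t) (P vj h t) s = lsol m a b f g h (n + s) := by
    intro s
    rw [← sol_eq_lsol hf.ne_zero hBi hBj]
    simp only [sol, caso, hPt hg, hPt hh]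
  have hev : ∀ᶠ τ in nhds t, ∀ k ∈ Finset.range m, v τ (n + k) ≠ 0 := by
    rw [Filter.eventually_all_finset]
    intro k _
    exact (hv (n + k)).continuousAt.eventually_ne (hi.1 _)
  -- `superP_mul` is an identity for arbitrary data, so no equation is needed at `τ ≠ t`, only that
  -- `v` does not vanish on the window.
  have hloc : ∀ᶠ τ in nhds t,
      superP m a b (window m (vi τ) n) (window m (vj τ) n) (window m (v τ) n) (s + 1) /
          superP m a b (window m (vi τ) n) (window m (vj τ) n) (window m (v τ) n) s
        = sol m a b (P vi g τ) (P vj h τ) (s + 1) / sol m a b (P vi g τ) (P vj h τ) s := by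
    filter_upwards [hev] with τ hτ
    let F : ℕ → ℝ := fun k => ∏ r ∈ Finset.range k, v τ (n + r)
    have hF : ∀ k ≤ m, F k ≠ 0 := fun k hk => Finset.prod_ne_zero_iff.2 fun r hr =>
      hτ r (by simp at hr ⊢; omega)
    have hVF : IsRatio (window m (v τ) n) F := fun k => by
      simp only [F, window, Finset.prod_range_succ, mul_comm]
    have hWF : ∀ (w : ℝ → ℤ → ℝ) (g : ℤ → ℝ),
        IsRatio (window m (w τ) n) fun k => F k * P w g τ k := by
      intro w g k
      have e1 := hF k k.2.le
      have e2 := hF (k + 1) k.2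
      have e3 := hf.ne_zero n
      simp only [P, window]
      change w τ (n + (k : ℕ)) * (F k * (g n / f n * (_ / F k)))
        = F (k + 1) * (g n / f n * (_ / F (k + 1)))
      rw [Finset.prod_range_succ]
      field_simp
    have h1 := superP_mul a b hVF (hWF vi g) (hWF vj h) s s.2.le
    have h2 := superP_mul a b hVF (hWF vi g) (hWF vj h) (s + 1) s.2
    have h3 : P vi g τ 0 * P vj h τ 0 * F 0 ^ 2 ≠ 0 := by
      simp only [P, F, Finset.range_zero, Finset.prod_empty, div_one, mul_one, one_pow]
      exact mul_ne_zero (hp0 n) (hq0 n)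
    rw [← mul_div_mul_right _ _ h3, h1, h2, mul_div_mul_left _ _ (pow_ne_zero 2 (hF m le_rfl))]
  -- The normalization term is the same multiple of `sol` at `s` and at `s + 1`, so it cancels in
  -- the quotient, leaving the difference of `flux / lsol` found in `hrate`.
  have hd := (hsol (s + 1)).div (hsol s) (by rw [hsolt]; exact hS _)
  refine ((hijτ.hasDerivAt hvij (n + (s : ℕ))).sub ((hf.hasDerivAt hv (n + (s : ℕ))).mul
    (hd.congr_of_eventuallyEq hloc))).congr_deriv ?_
  rw [hratio n s s.2, hsolt, hsolt]
  have h1 := hrate (n + (s : ℕ))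
  rw [sub_eq_iff_eq_add] at h1
  rw [h1, hijτ.eq_div, hf.eq_div]
  push_cast
  rw [← add_assoc]
  have e1 := hS (n + (s : ℕ))
  have e2 := hS (n + (s : ℕ) + 1)
  have e3 := hf.ne_zero (n + (s : ℕ))
  field_simp
  ring

end MQuad

theorem theorem2 {ι : Type*} (m : ℕ) (hm : 1 ≤ m) (α : ι → ℝ)
    (hα0 : ∀ i, α i ≠ 0) (hα : ∀ i j, i ≠ j → α i ≠ α j) :
    (MQuad.dSK m α).MultidimensionallyConsistent ∧
    MQuad.ConsistentWithLattice m α (MQuad.vLattice m) ∧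
    (∀ (v : ℝ → ℤ → ℝ) (t : ℝ), (∀ n, v t n ≠ 0) → MQuad.SolvesAt (MQuad.vLattice m) v t →
      MQuad.SolvesAt (MQuad.uLattice m) (fun τ n => v τ (n + m) / v τ n) t) := by
  refine ⟨MQuad.multidimensionallyConsistent_dSK m hm α hα0 hα, ⟨?_, ?_⟩, ?_⟩
  · intro i v vi t h hv hvi n
    exact MQuad.hasDerivAt_quadExpr (hα0 i) h hv hvi n
  · intro i j _ v vi vj vij t hi hj hij _ hR hv hvi hvj hvij n s
    exact MQuad.hasDerivAt_superpos hm (hα0 i) (hα0 j) hi hj hij hR hv hvi hvj hvij n s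
  · intro v t h0 hv
    exact MQuad.solvesAt_uLattice hm h0 hv
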